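/- All graphs are finite, without loops or parallel edges; $|G|$ denotes the number of vertices of $G$. A subdivision of a graph $H$ is a graph obtained from $H$ by replacing each edge $uv$ by a path of length at least one between $u$ and $v$, where the interiors of these paths are pairwise disjoint and contain no vertex of $H$. A graph $G$ contains an induced subdivision of $H$ if some induced subgraph of $G$ is isomorphic to a subdivision of $H$. **Theorem.** For every graph $H$ there exists $c>0$ such that for every graph $G$, at least one of the following holds: - $G$ or its complement $\overline{G}$ contains an induced subdivision of $H$; - $G$ contains a clique or stable set of size at least $|G|^c$. (In other words, there is some $c>0$ such that every graph $G$ for which neither $G$ nor $\overline{G}$ contains an induced subdivision of $H$ has a clique or stable set of size at least $|G|^c$; that is, the class of such graphs has the Erdős–Hajnal property.) -/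

import Mathlib

/-- The data showing that the graph `J` is a subdivision of the graph `H`: the vertices of `H` are
sent injectively to branch vertices of `J`, and every edge `uv` of `H` is replaced by a path of `J`
between the branch vertices of `u` and `v` (of any length at least one, so an edge need not be
subdivided). These paths have no branch vertices in their interiors, are pairwise internally
disjoint, and together with the branch vertices they make up all of `J`. -/
structure SubdivisionModel {U : Type*} {W : Type*} (H : SimpleGraph U) (J : SimpleGraph W) where
  /-- The branch vertex of each vertex of `H`. -/
  branch : U ↪ W
  /-- The path of `J` replacing the edge `uv` of `H`, directed from `u` to `v`. -/
  path : ∀ u v : U, H.Adj u v → J.Walk (branch u) (branch v)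
  isPath : ∀ (u v : U) (h : H.Adj u v), (path u v h).IsPath
  /-- Each edge gives one path, whichever of its two directions is used. -/
  path_symm : ∀ (u v : U) (h : H.Adj u v), path v u h.symm = (path u v h).reverse
  /-- The only branch vertices on a path are its two ends. -/
  branch_mem_support : ∀ (u v : U) (h : H.Adj u v) (x : U),
    branch x ∈ (path u v h).support → x = u ∨ x = v
  /-- The paths of two different edges of `H` meet in branch vertices only. -/
  internally_disjoint : ∀ (u v : U) (h : H.Adj u v) (u' v' : U) (h' : H.Adj u' v'),
    s(u, v) ≠ s(u', v') → ∀ w : W, w ∈ (path u v h).support → w ∈ (path u' v' h').support →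
      w ∈ Set.range branch
  /-- Every vertex of `J` is a branch vertex or lies on one of the paths. -/
  vertex_cover : ∀ w : W, w ∈ Set.range branch ∨
    ∃ (u v : U) (h : H.Adj u v), w ∈ (path u v h).support
  /-- Every edge of `J` is an edge of one of the paths. -/
  edge_cover : ∀ e ∈ J.edgeSet, ∃ (u v : U) (h : H.Adj u v), e ∈ (path u v h).edges

/-- `J` is (isomorphic to) a subdivision of `H`. -/
def IsSubdivisionOf {U : Type*} {W : Type*} (J : SimpleGraph W) (H : SimpleGraph U) : Prop :=
  Nonempty (SubdivisionModel H J)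

/-- Some induced subgraph of `G` is a subdivision of `H`. -/
def ContainsInducedSubdivision {V : Type*} {U : Type*} (G : SimpleGraph V)
    (H : SimpleGraph U) : Prop :=
  ∃ s : Set V, IsSubdivisionOf (G.induce s) H

/-- A nonempty finite set of vertices with no proper nonempty part closed under adjacency. -/
def CutConnected {V : Type*} (G : SimpleGraph V) (Z : Finset V) : Prop :=
  Z.Nonempty ∧ ∀ A ⊆ Z, A.Nonempty → (∀ a ∈ A, ∀ b ∈ Z, G.Adj a b → b ∈ A) → A = Z

/-- Branch vertices and connected sets from which an induced subdivision can be extracted. -/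
structure SubdivisionTemplate {V U : Type*} (G : SimpleGraph V) (H : SimpleGraph U) where
  vert : U → V
  inj : Function.Injective vert
  not_adj : ∀ u w, ¬ G.Adj (vert u) (vert w)
  link : Sym2 U → Finset V
  conn : ∀ e ∈ H.edgeSet, CutConnected G (link e)
  attach : ∀ e ∈ H.edgeSet, ∀ u ∈ e, ∃ a ∈ link e, G.Adj (vert u) a
  not_mem : ∀ e ∈ H.edgeSet, ∀ u, vert u ∉ link e
  no_attach : ∀ e ∈ H.edgeSet, ∀ u, u ∉ e → ∀ a ∈ link e, ¬ G.Adj (vert u) a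
  apart : ∀ e ∈ H.edgeSet, ∀ f ∈ H.edgeSet, e ≠ f → ∀ a ∈ link e, ∀ b ∈ link f,
    a ≠ b ∧ ¬ G.Adj a b

theorem CutConnected.induce_connected {V : Type*} {G : SimpleGraph V} {Z : Finset V}
    (h : CutConnected G Z) : (G.induce (Z : Set V)).Connected := by
  classical
  obtain ⟨⟨z, hz⟩, hc⟩ := h
  have key : ∀ x (hx : x ∈ Z), (G.induce (Z : Set V)).Reachable ⟨z, hz⟩ ⟨x, hx⟩ := by
    have := hc (Z.filter fun x => ∃ hx : x ∈ Z, (G.induce (Z : Set V)).Reachable ⟨z, hz⟩ ⟨x, hx⟩)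
      (Finset.filter_subset _ _) ⟨z, by simp [hz]⟩ (by
        intro a ha b hb hab
        simp only [Finset.mem_filter] at ha ⊢
        obtain ⟨_, ha, hr⟩ := ha
        refine ⟨hb, hb, hr.trans (SimpleGraph.Adj.reachable ?_)⟩
        simpa using hab)
    intro x hx
    rw [← this] at hx
    simp only [Finset.mem_filter] at hx
    exact hx.2.2
  have : Nonempty (Z : Set V) := ⟨⟨z, hz⟩⟩
  refine SimpleGraph.Connected.mk fun a b => ?_
  exact (key a.1 a.2).symm.trans (key b.1 b.2)

theorem SimpleGraph.Walk.dist_getVert_of_length_eq_dist {W : Type*} {J : SimpleGraph W}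
    (hJ : J.Connected) {a b : W} (p : J.Walk a b) (hp : p.length = J.dist a b) {i : ℕ} (hi : i ≤ p.length) :
    J.dist a (p.getVert i) = i := by
  have h1 : J.dist a (p.getVert i) ≤ i := by
    have := SimpleGraph.dist_le (p.take i)
    rw [SimpleGraph.Walk.take_length] at this
    exact this.trans (min_le_left _ _)
  have h2 : J.dist (p.getVert i) b ≤ p.length - i := by
    have := SimpleGraph.dist_le (p.drop i)
    rwa [SimpleGraph.Walk.drop_length] at this
  have h3 := hJ.dist_triangle (u := a) (v := p.getVert i) (w := b)
  omega

theorem SimpleGraph.Walk.mem_edges_of_length_eq_dist {W : Type*} {J : SimpleGraph W}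
    (hJ : J.Connected) {a b : W} (p : J.Walk a b) (hp : p.length = J.dist a b) {x y : W}
    (hx : x ∈ p.support) (hy : y ∈ p.support) (hxy : J.Adj x y) : s(x, y) ∈ p.edges := by
  rw [SimpleGraph.Walk.mem_support_iff_exists_getVert] at hx hy
  obtain ⟨i, rfl, hi⟩ := hx
  obtain ⟨j, rfl, hj⟩ := hy
  have hdi := p.dist_getVert_of_length_eq_dist hJ hp hi
  have hdj := p.dist_getVert_of_length_eq_dist hJ hp hj
  have hd := hxy.diff_dist_adj (u := a)
  rw [hdi, hdj] at hd
  rw [← SimpleGraph.Walk.mem_edges_toSubgraph, SimpleGraph.Subgraph.mem_edgeSet,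
    SimpleGraph.Walk.toSubgraph_adj_iff]
  rcases hd with hd | hd | hd
  · subst hd; exact absurd hxy (J.loopless.irrefl _)
  · exact ⟨i, by rw [← hd], by omega⟩
  · rcases i with _ | i
    · have : j = 0 := by omega
      subst this; exact absurd hxy (J.loopless.irrefl _)
    · have : j = i := by omega
      subst this
      exact ⟨j, Sym2.eq_swap, by omega⟩

theorem CutConnected.insert {V : Type*} [DecidableEq V] {G : SimpleGraph V} {Z : Finset V}
    (h : CutConnected G Z) {x z : V} (hz : z ∈ Z) (hxz : G.Adj x z) :
    CutConnected G (insert x Z) := by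
  refine ⟨⟨x, by simp⟩, fun A hA hne hcl => ?_⟩
  have hmeet : (A ∩ Z).Nonempty := by
    obtain ⟨a, ha⟩ := hne
    rcases Finset.mem_insert.1 (hA ha) with rfl | haZ
    · exact ⟨z, by simp [hz, hcl a ha z (by simp [hz]) hxz]⟩
    · exact ⟨a, by simp [ha, haZ]⟩
  have hZ : A ∩ Z = Z := h.2 _ Finset.inter_subset_right hmeet fun a ha b hb hab => by
    simp only [Finset.mem_inter] at ha ⊢
    exact ⟨hcl a ha.1 b (by simp [hb]) hab, hb⟩
  have hZA : Z ⊆ A := by rw [← hZ]; exact Finset.inter_subset_left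
  refine Finset.Subset.antisymm hA fun b hb => ?_
  rcases Finset.mem_insert.1 hb with rfl | hb
  · exact hcl z (hZA hz) b (by simp) hxz.symm
  · exact hZA hb

/-- A connected set contains a chordless path between any two of its vertices. -/
theorem CutConnected.exists_chordless_path {V : Type*} {G : SimpleGraph V} {Z : Finset V}
    (h : CutConnected G Z) {a b : V} (ha : a ∈ Z) (hb : b ∈ Z) :
    ∃ p : G.Walk a b, p.IsPath ∧ (∀ x ∈ p.support, x ∈ Z) ∧
      ∀ x ∈ p.support, ∀ y ∈ p.support, G.Adj x y → s(x, y) ∈ p.edges := by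
  have hc := h.induce_connected
  obtain ⟨q, hq⟩ := hc.exists_walk_length_eq_dist ⟨a, ha⟩ ⟨b, hb⟩
  refine ⟨q.map (SimpleGraph.Embedding.induce _).toHom,
    (q.isPath_of_length_eq_dist hq).map Subtype.val_injective, ?_, ?_⟩
  · intro x hx
    erw [SimpleGraph.Walk.support_map, List.mem_map] at hx
    obtain ⟨y, -, rfl⟩ := hx
    exact y.2
  · intro x hx y hy hxy
    erw [SimpleGraph.Walk.support_map, List.mem_map] at hx hy
    obtain ⟨x, hx, rfl⟩ := hx
    obtain ⟨y, hy, rfl⟩ := hy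
    erw [SimpleGraph.Walk.edges_map, List.mem_map]
    exact ⟨s(x, y), q.mem_edges_of_length_eq_dist hc hq hx hy hxy, rfl⟩

namespace SubdivisionTemplate

variable {V U : Type*} {G : SimpleGraph V} {H : SimpleGraph U}

theorem exists_path (T : SubdivisionTemplate G H) {u w : U} (h : H.Adj u w) :
    ∃ p : G.Walk (T.vert u) (T.vert w), p.IsPath ∧
      (∀ x ∈ p.support, x ∈ T.link s(u, w) ∨ x = T.vert u ∨ x = T.vert w) ∧
      ∀ x ∈ p.support, ∀ y ∈ p.support, G.Adj x y → s(x, y) ∈ p.edges := by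
  classical
  obtain ⟨a, ha, hua⟩ := T.attach s(u, w) h u (by simp)
  obtain ⟨b, hb, hwb⟩ := T.attach s(u, w) h w (by simp)
  have hconn := ((T.conn s(u, w) h).insert ha hua).insert (Finset.mem_insert_of_mem hb) hwb
  obtain ⟨p, hp, hs, hc⟩ := hconn.exists_chordless_path
    (a := T.vert u) (b := T.vert w) (by simp) (by simp)
  refine ⟨p, hp, fun x hx => ?_, hc⟩
  have := hs x hx
  simp only [Finset.mem_insert] at this
  tauto

/-- The chordless paths can be chosen independently of the direction of each edge. -/
theorem exists_paths (T : SubdivisionTemplate G H) :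
    ∃ P : ∀ u w, H.Adj u w → G.Walk (T.vert u) (T.vert w),
      (∀ u w h, (P u w h).IsPath) ∧ (∀ u w h, P w u h.symm = (P u w h).reverse) ∧
      (∀ u w h, ∀ x ∈ (P u w h).support, x ∈ T.link s(u, w) ∨ x = T.vert u ∨ x = T.vert w) ∧
      ∀ u w h, ∀ x ∈ (P u w h).support, ∀ y ∈ (P u w h).support, G.Adj x y →
        s(x, y) ∈ (P u w h).edges := by
  classical
  choose q hq1 hq2 hq3 using fun u w (h : H.Adj u w) => T.exists_path h
  let P : ∀ u w, H.Adj u w → G.Walk (T.vert u) (T.vert w) := fun u w h =>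
    if WellOrderingRel u w then q u w h else (q w u h.symm).reverse
  refine ⟨P, fun u w h => ?_, fun u w h => ?_, fun u w h => ?_, fun u w h => ?_⟩
  · by_cases huw : WellOrderingRel u w
    · simp only [P, if_pos huw]; exact hq1 u w h
    · simp only [P, if_neg huw]; exact (hq1 w u h.symm).reverse
  · by_cases huw : WellOrderingRel u w
    · have hwu : ¬ WellOrderingRel w u := fun h' => asymm huw h'
      simp only [P, if_pos huw, if_neg hwu]
    · have hwu : WellOrderingRel w u := by
        rcases trichotomous_of WellOrderingRel u w with h' | h' | h'
        · exact absurd h' huw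
        · exact absurd h' h.ne
        · exact h'
      simp only [P, if_neg huw, if_pos hwu, SimpleGraph.Walk.reverse_reverse]
  · by_cases huw : WellOrderingRel u w
    · simp only [P, if_pos huw]; exact hq2 u w h
    · simp only [P, if_neg huw, SimpleGraph.Walk.support_reverse, List.mem_reverse]
      intro x hx
      rw [Sym2.eq_swap]
      exact (hq2 w u h.symm x hx).imp id Or.symm
  · by_cases huw : WellOrderingRel u w
    · simp only [P, if_pos huw]; exact hq3 u w h
    · simp only [P, if_neg huw, SimpleGraph.Walk.support_reverse, List.mem_reverse,
        SimpleGraph.Walk.edges_reverse]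
      exact hq3 w u h.symm

theorem containsInducedSubdivision (T : SubdivisionTemplate G H) :
    ContainsInducedSubdivision G H := by
  obtain ⟨P, hpath, hsymm, hsupp, hchord⟩ := T.exists_paths
  let S : Set V := {x | x ∈ Set.range T.vert ∨ ∃ u w h, x ∈ (P u w h).support}
  have hS : ∀ u w h, ∀ x ∈ (P u w h).support, x ∈ S := fun u w h x hx => Or.inr ⟨u, w, h, hx⟩
  have hswap : ∀ u w h u' w' h', s(u, w) = s(u', w') →
      ∀ x ∈ (P u w h).support, x ∈ (P u' w' h').support := by
    intro u w h u' w' h' he x hx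
    rcases Sym2.eq_iff.1 he with ⟨rfl, rfl⟩ | ⟨rfl, rfl⟩
    · exact hx
    · rw [hsymm _ _ h]; simpa using hx
  have hedge : ∀ x ∈ S, ∀ y ∈ S, G.Adj x y →
      ∃ u w h, x ∈ (P u w h).support ∧ y ∈ (P u w h).support := by
    have hbranch : ∀ a, ∀ y ∈ S, G.Adj (T.vert a) y →
        ∃ u w h, T.vert a ∈ (P u w h).support ∧ y ∈ (P u w h).support := by
      rintro a y (⟨b, rfl⟩ | ⟨u, w, h, hy⟩) hay
      · exact absurd hay (T.not_adj a b)
      · rcases hsupp u w h y hy with hl | rfl | rfl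
        · by_cases ha : a ∈ s(u, w)
          · refine ⟨u, w, h, ?_, hy⟩
            rcases Sym2.mem_iff.1 ha with rfl | rfl
            · exact SimpleGraph.Walk.start_mem_support _
            · exact SimpleGraph.Walk.end_mem_support _
          · exact absurd hay (T.no_attach s(u, w) h a ha y hl)
        · exact absurd hay (T.not_adj _ _)
        · exact absurd hay (T.not_adj _ _)
    intro x hx y hy hxy
    have hx' := hx
    have hy' := hy
    rcases hx with ⟨a, rfl⟩ | ⟨u, w, h, hx⟩
    · exact hbranch a y hy hxy
    · rcases hsupp u w h x hx with hlx | rfl | rfl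
      · rcases hy with ⟨b, rfl⟩ | ⟨u', w', h', hy⟩
        · obtain ⟨u, w, h, h1, h2⟩ := hbranch b x hx' hxy.symm
          exact ⟨u, w, h, h2, h1⟩
        · rcases hsupp u' w' h' y hy with hly | rfl | rfl
          · by_cases he : s(u', w') = s(u, w)
            · exact ⟨u, w, h, hx, hswap _ _ h' _ _ h he y hy⟩
            · exact absurd hxy (T.apart _ h _ h' (Ne.symm he) x hlx y hly).2
          · obtain ⟨u, w, h, h1, h2⟩ := hbranch _ x hx' hxy.symm
            exact ⟨u, w, h, h2, h1⟩
          · obtain ⟨u, w, h, h1, h2⟩ := hbranch _ x hx' hxy.symm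
            exact ⟨u, w, h, h2, h1⟩
      · exact hbranch _ y hy' hxy
      · exact hbranch _ y hy' hxy
  have hmem : ∀ u w h (x : S), x ∈ ((P u w h).induce S (hS u w h)).support ↔
      x.1 ∈ (P u w h).support := by
    intro u w h x
    simp [SimpleGraph.Walk.support_induce, List.mem_attachWith]
  refine ⟨S, ⟨⟨⟨fun u => ⟨T.vert u, Or.inl ⟨u, rfl⟩⟩, fun u w h => T.inj (congrArg Subtype.val h)⟩,
    fun u w h => (P u w h).induce S (hS u w h), fun u w h => ?_, fun u w h => ?_, ?_, ?_, ?_, ?_⟩⟩⟩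
  · refine SimpleGraph.Walk.IsPath.of_map (f := (SimpleGraph.Embedding.induce S).toHom) ?_
    rw [SimpleGraph.Walk.map_induce]
    exact hpath u w h
  · apply SimpleGraph.Walk.map_injective_of_injective
      (f := (SimpleGraph.Embedding.induce S).toHom) Subtype.val_injective
    rw [← SimpleGraph.Walk.reverse_map, SimpleGraph.Walk.map_induce, SimpleGraph.Walk.map_induce]
    exact hsymm u w h
  · intro u w h x hx
    rw [hmem] at hx
    rcases hsupp u w h _ hx with hl | hl | hl
    · exact absurd hl (T.not_mem s(u, w) h x)
    · exact Or.inl (T.inj hl)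
    · exact Or.inr (T.inj hl)
  · intro u w h u' w' h' hne x hx hx'
    rw [hmem] at hx hx'
    rcases hsupp u w h _ hx with hl | hl | hl
    · rcases hsupp u' w' h' _ hx' with hl' | hl' | hl'
      · exact absurd rfl (T.apart _ h _ h' hne _ hl _ hl').1
      · exact ⟨u', Subtype.ext hl'.symm⟩
      · exact ⟨w', Subtype.ext hl'.symm⟩
    · exact ⟨u, Subtype.ext hl.symm⟩
    · exact ⟨w, Subtype.ext hl.symm⟩
  · rintro ⟨x, hx⟩
    rcases hx with ⟨u, rfl⟩ | ⟨u, w, h, hx⟩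
    · exact Or.inl ⟨u, rfl⟩
    · exact Or.inr ⟨u, w, h, (hmem u w h _).2 hx⟩
  · intro e
    induction e with
    | _ x y =>
      intro hxy
      obtain ⟨u, w, h, hx, hy⟩ := hedge x.1 x.2 y.1 y.2 hxy
      refine ⟨u, w, h, ?_⟩
      have := hchord u w h _ hx _ hy hxy
      rw [← SimpleGraph.Walk.map_induce (P u w h) (hS u w h)] at this
      erw [SimpleGraph.Walk.edges_map, List.mem_map] at this
      obtain ⟨e, he, hee⟩ := this
      have : e = s(x, y) := Sym2.map.injective Subtype.val_injective hee
      rwa [← this]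

/-- Templates transfer along embeddings of graphs as induced subgraphs. -/
def map {V' : Type*} {G' : SimpleGraph V'} (T : SubdivisionTemplate G H) (f : G ↪g G') :
    SubdivisionTemplate G' H where
  vert u := f (T.vert u)
  inj := f.injective.comp T.inj
  not_adj u w h := T.not_adj u w (f.map_adj_iff.1 h)
  link e := (T.link e).map f.toEmbedding
  conn e he := by
    classical
    obtain ⟨⟨z, hz⟩, hc⟩ := T.conn e he
    refine ⟨⟨f z, by simpa using hz⟩, fun A hA hne hcl => ?_⟩
    have h1 := hc ((T.link e).filter fun a => f a ∈ A) (Finset.filter_subset _ _) (by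
      obtain ⟨a, ha⟩ := hne
      obtain ⟨b, hb, rfl⟩ := Finset.mem_map.1 (hA ha)
      exact ⟨b, by simpa [hb] using ha⟩) (by
      intro a ha b hb hab
      simp only [Finset.mem_filter] at ha ⊢
      exact ⟨hb, hcl _ ha.2 _ (by simpa using hb) (f.map_adj_iff.2 hab)⟩)
    refine Finset.Subset.antisymm hA fun b hb => ?_
    obtain ⟨b, hb, rfl⟩ := Finset.mem_map.1 hb
    replace hb : b ∈ (T.link e).filter fun a => f a ∈ A := by rwa [h1]
    exact (Finset.mem_filter.1 hb).2
  attach e he u hu := by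
    obtain ⟨a, ha, h⟩ := T.attach e he u hu
    exact ⟨f a, by simpa using ha, f.map_adj_iff.2 h⟩
  not_mem e he u h := T.not_mem e he u (by simpa using h)
  no_attach e he u hu a ha h := by
    obtain ⟨a, ha', rfl⟩ := Finset.mem_map.1 ha
    exact T.no_attach e he u hu a ha' (f.map_adj_iff.1 h)
  apart e he e' he' hne a ha b hb := by
    obtain ⟨a, ha', rfl⟩ := Finset.mem_map.1 ha
    obtain ⟨b, hb', rfl⟩ := Finset.mem_map.1 hb
    have := T.apart e he e' he' hne a ha' b hb'
    exact ⟨fun h => this.1 (f.injective h), fun h => this.2 (f.map_adj_iff.1 h)⟩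

end SubdivisionTemplate

open scoped Classical in
/-- The vertices lying in `Z` or adjacent to a vertex of `Z`. -/
noncomputable def closedNbhd {V : Type*} [Fintype V] (G : SimpleGraph V) (Z : Finset V) :
    Finset V :=
  Finset.univ.filter fun x => x ∈ Z ∨ ∃ z ∈ Z, G.Adj z x

/-- Two disjoint sets of vertices with no edges between them. -/
def Anticomplete {V : Type*} (G : SimpleGraph V) (A B : Finset V) : Prop :=
  ∀ a ∈ A, ∀ b ∈ B, a ≠ b ∧ ¬ G.Adj a b

theorem Anticomplete.symm {V : Type*} {G : SimpleGraph V} {A B : Finset V}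
    (h : Anticomplete G A B) : Anticomplete G B A :=
  fun b hb a ha => ⟨(h a ha b hb).1.symm, fun hab => (h a ha b hb).2 hab.symm⟩

theorem Anticomplete.mono {V : Type*} {G : SimpleGraph V} {A B A' B' : Finset V}
    (h : Anticomplete G A B) (hA : A' ⊆ A) (hB : B' ⊆ B) : Anticomplete G A' B' :=
  fun a ha b hb => h a (hA ha) b (hB hb)

section
open scoped Classical

section
variable {V : Type*} [Fintype V] {G : SimpleGraph V}

theorem mem_closedNbhd {Z : Finset V} {x : V} :
    x ∈ closedNbhd G Z ↔ x ∈ Z ∨ ∃ z ∈ Z, G.Adj z x := by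
  simp [closedNbhd]

theorem subset_closedNbhd (Z : Finset V) : Z ⊆ closedNbhd G Z :=
  fun _ hx => mem_closedNbhd.2 (Or.inl hx)

theorem mem_closedNbhd_singleton {v x : V} :
    x ∈ closedNbhd G {v} ↔ x = v ∨ G.Adj v x := by
  simp [mem_closedNbhd]

theorem closedNbhd_biUnion {ι : Type*} (I : Finset ι) (Z : ι → Finset V) :
    closedNbhd G (I.biUnion Z) = I.biUnion fun i => closedNbhd G (Z i) := by
  ext x
  simp only [mem_closedNbhd, Finset.mem_biUnion]
  constructor
  · rintro (⟨i, hi, hx⟩ | ⟨z, ⟨i, hi, hz⟩, h⟩)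
    · exact ⟨i, hi, Or.inl hx⟩
    · exact ⟨i, hi, Or.inr ⟨z, hz, h⟩⟩
  · rintro ⟨i, hi, hx | ⟨z, hz, h⟩⟩
    · exact Or.inl ⟨i, hi, hx⟩
    · exact Or.inr ⟨z, ⟨i, hi, hz⟩, h⟩

theorem closedNbhd_union (Y Z : Finset V) :
    closedNbhd G (Y ∪ Z) = closedNbhd G Y ∪ closedNbhd G Z := by
  ext x
  simp only [mem_closedNbhd, Finset.mem_union]
  constructor
  · rintro ((h | h) | ⟨z, h | h, h'⟩)
    · exact Or.inl (Or.inl h)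
    · exact Or.inr (Or.inl h)
    · exact Or.inl (Or.inr ⟨z, h, h'⟩)
    · exact Or.inr (Or.inr ⟨z, h, h'⟩)
  · rintro ((h | ⟨z, h, h'⟩) | (h | ⟨z, h, h'⟩))
    · exact Or.inl (Or.inl h)
    · exact Or.inr ⟨z, Or.inl h, h'⟩
    · exact Or.inl (Or.inr h)
    · exact Or.inr ⟨z, Or.inr h, h'⟩

theorem anticomplete_of_disjoint_closedNbhd {Z X : Finset V}
    (h : ∀ x ∈ X, x ∉ closedNbhd G Z) : Anticomplete G Z X := by
  intro a ha b hb
  have := h b hb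
  rw [mem_closedNbhd] at this
  push Not at this
  exact ⟨fun hab => this.1 (hab ▸ ha), this.2 a ha⟩

end

namespace CutConnected

variable {V : Type*} {G : SimpleGraph V}

theorem subset_of_closed {Z Y A : Finset V} (h : CutConnected G Z) (hZY : Z ⊆ Y)
    (hcl : ∀ a ∈ A, ∀ b ∈ Y, G.Adj a b → b ∈ A) {x : V} (hxA : x ∈ A) (hxZ : x ∈ Z) : Z ⊆ A := by
  have : A ∩ Z = Z := h.2 _ Finset.inter_subset_right ⟨x, by simp [hxA, hxZ]⟩
    fun a ha b hb hab => by
      simp only [Finset.mem_inter] at ha ⊢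
      exact ⟨hcl a ha.1 b (hZY hb) hab, hb⟩
  rw [← this]
  exact Finset.inter_subset_left

theorem singleton (v : V) : CutConnected G {v} := by
  refine ⟨by simp, fun A hA hne _ => ?_⟩
  exact (Finset.Nonempty.subset_singleton_iff hne).1 hA

theorem union {Y Z : Finset V} (hY : CutConnected G Y) (hZ : CutConnected G Z) {y z : V}
    (hy : y ∈ Y) (hz : z ∈ Z) (hyz : y = z ∨ G.Adj y z) : CutConnected G (Y ∪ Z) := by
  refine ⟨⟨y, by simp [hy]⟩, fun A hA ⟨x, hx⟩ hcl => ?_⟩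
  refine Finset.Subset.antisymm hA ?_
  have hYA : ∀ x ∈ A, x ∈ Y → Y ⊆ A := fun x hx hxY =>
    hY.subset_of_closed Finset.subset_union_left hcl hx hxY
  have hZA : ∀ x ∈ A, x ∈ Z → Z ⊆ A := fun x hx hxZ =>
    hZ.subset_of_closed Finset.subset_union_right hcl hx hxZ
  have hyA : y ∈ A → z ∈ A := fun h => by
    rcases hyz with rfl | hyz
    · exact h
    · exact hcl y h z (by simp [hz]) hyz
  have hzA : z ∈ A → y ∈ A := fun h => by
    rcases hyz with rfl | hyz
    · exact h
    · exact hcl z h y (by simp [hy]) hyz.symm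
  rcases Finset.mem_union.1 (hA hx) with hxY | hxZ
  · have h1 := hYA x hx hxY
    exact Finset.union_subset h1 (hZA z (hyA (h1 hy)) hz)
  · have h1 := hZA x hx hxZ
    exact Finset.union_subset (hYA y (hzA (h1 hz)) hy) h1

theorem biUnion {ι : Type*} {I : Finset ι} (hI : I.Nonempty) {Z : ι → Finset V} {z : V}
    (hZ : ∀ i ∈ I, CutConnected G (Z i)) (hz : ∀ i ∈ I, z ∈ Z i) :
    CutConnected G (I.biUnion Z) := by
  obtain ⟨i₀, hi₀⟩ := hI
  refine ⟨⟨z, Finset.mem_biUnion.2 ⟨i₀, hi₀, hz i₀ hi₀⟩⟩, fun A hA ⟨x, hx⟩ hcl => ?_⟩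
  refine Finset.Subset.antisymm hA ?_
  have key : ∀ i ∈ I, ∀ x ∈ A, x ∈ Z i → Z i ⊆ A := fun i hi x hx hxi =>
    (hZ i hi).subset_of_closed (Finset.subset_biUnion_of_mem Z hi) hcl hx hxi
  obtain ⟨i, hi, hxi⟩ := Finset.mem_biUnion.1 (hA hx)
  have hzA := key i hi x hx hxi (hz i hi)
  exact Finset.biUnion_subset.2 fun j hj => key j hj z hzA (hz j hj)

theorem exists_adj_of_ssubset {C Z : Finset V} (h : CutConnected G C) (hZC : Z ⊆ C)
    (hZ : Z.Nonempty) (hne : Z ≠ C) : ∃ a ∈ Z, ∃ b ∈ C, b ∉ Z ∧ G.Adj a b := by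
  by_contra! hcon
  refine hne (h.2 Z hZC hZ fun a ha b hb hab => ?_)
  by_contra hbZ
  exact hcon a ha b hb hbZ hab

end CutConnected

/-- All neighbourhoods are small, and so is one of any two sets with no edges between them. -/
structure IsCoherent {V : Type*} [Fintype V] (G : SimpleGraph V) (ε : ℝ) : Prop where
  card_closedNbhd_le : ∀ v, ((closedNbhd G {v}).card : ℝ) ≤ ε * Fintype.card V
  card_lt_or_card_lt : ∀ A B, Anticomplete G A B →
    (A.card : ℝ) < ε * Fintype.card V ∨ (B.card : ℝ) < ε * Fintype.card V

section
variable {V : Type*} [Fintype V] {G : SimpleGraph V} {ε : ℝ}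

theorem IsCoherent.one_le (h : IsCoherent G ε) [Nonempty V] : 1 ≤ ε * Fintype.card V := by
  obtain ⟨v⟩ := ‹Nonempty V›
  refine le_trans ?_ (h.card_closedNbhd_le v)
  exact_mod_cast Finset.card_pos.2 ⟨v, subset_closedNbhd _ (by simp)⟩

theorem IsCoherent.card_sdiff_closedNbhd_lt (h : IsCoherent G ε) {A : Finset V}
    (hA : ε * Fintype.card V ≤ A.card) (X : Finset V) :
    ((X \ closedNbhd G A).card : ℝ) < ε * Fintype.card V := by
  rcases h.card_lt_or_card_lt A (X \ closedNbhd G A)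
    (anticomplete_of_disjoint_closedNbhd fun x hx => (Finset.mem_sdiff.1 hx).2) with h' | h'
  · exact absurd hA (not_le.2 h')
  · exact h'

theorem IsCoherent.exists_cutConnected [Nonempty V] (h : IsCoherent G ε) {X : Finset V}
    (hX : 3 * (ε * Fintype.card V) ≤ X.card) :
    ∃ C ⊆ X, CutConnected G C ∧ ((X \ C).card : ℝ) < ε * Fintype.card V := by
  have h1 := h.one_le
  set N : ℝ := ε * Fintype.card V with hN
  let F : Finset (Finset V) := X.powerset.filter fun D =>
    (∀ a ∈ D, ∀ b ∈ X, G.Adj a b → b ∈ D) ∧ N ≤ D.card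
  have hXF : X ∈ F := by
    simp only [F, Finset.mem_filter, Finset.mem_powerset]
    exact ⟨subset_rfl, fun _ _ b hb _ => hb, by linarith⟩
  obtain ⟨D, hD, hmin⟩ := Finset.exists_min_image F Finset.card ⟨X, hXF⟩
  simp only [F, Finset.mem_filter, Finset.mem_powerset] at hD hmin
  obtain ⟨hDX, hDcl, hDN⟩ := hD
  have hout : ((X \ D).card : ℝ) < N := by
    rcases h.card_lt_or_card_lt D (X \ D) (fun a ha b hb => by
      rw [Finset.mem_sdiff] at hb
      exact ⟨fun hab => hb.2 (hab ▸ ha), fun hab => hb.2 (hDcl a ha b hb.1 hab)⟩) with h' | h'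
    · exact absurd hDN (not_le.2 h')
    · exact h'
  refine ⟨D, hDX, ⟨?_, fun A hA hne hcl => ?_⟩, hout⟩
  · rw [← Finset.card_pos]
    have : (0 : ℝ) < D.card := by linarith
    exact_mod_cast this
  · by_contra hAD
    have hAcl : ∀ a ∈ A, ∀ b ∈ X, G.Adj a b → b ∈ A := fun a ha b hb hab =>
      hcl a ha b (hDcl a (hA ha) b hb hab) hab
    have hDAcl : ∀ a ∈ D \ A, ∀ b ∈ X, G.Adj a b → b ∈ D \ A := fun a ha b hb hab => by
      rw [Finset.mem_sdiff] at ha ⊢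
      exact ⟨hDcl a ha.1 b hb hab, fun hbA => ha.2 (hcl b hbA a ha.1 hab.symm)⟩
    have hcard : (D \ A).card + A.card = D.card := Finset.card_sdiff_add_card_eq_card hA
    have hApos := Finset.card_pos.2 hne
    have hAlt := Finset.card_lt_card (hA.ssubset_of_ne hAD)
    have hA' : (A.card : ℝ) < N := by
      by_contra! hge
      have := hmin A ⟨hA.trans hDX, hAcl, hge⟩
      omega
    have hDA' : ((D \ A).card : ℝ) < N := by
      by_contra! hge
      have := hmin (D \ A) ⟨Finset.sdiff_subset.trans hDX, hDAcl, hge⟩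
      omega
    have hXD : (X \ D).card + D.card = X.card := Finset.card_sdiff_add_card_eq_card hDX
    have h2 : ((D \ A).card : ℝ) + A.card = D.card := by exact_mod_cast hcard
    have h3 : ((X \ D).card : ℝ) + D.card = X.card := by exact_mod_cast hXD
    linarith

end

/-- `z` and `s` lie in a connected subset of `S` with a closed neighbourhood of size
at most `m`. -/
def SmallJoined {V : Type*} [Fintype V] (G : SimpleGraph V) (m : ℝ) (S : Finset V)
    (z s : V) : Prop :=
  ∃ Z ⊆ S, CutConnected G Z ∧ z ∈ Z ∧ s ∈ Z ∧ ((closedNbhd G Z).card : ℝ) ≤ m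

/-- Every vertex of `T` is seen by a connected subset of `Q` with small neighbourhood, and these
subsets have a common vertex. -/
def IsBroom {V : Type*} [Fintype V] (G : SimpleGraph V) (m : ℝ) (Q T : Finset V) : Prop :=
  ∃ z, ∀ t ∈ T, ∃ Z ⊆ Q, CutConnected G Z ∧ z ∈ Z ∧ ((closedNbhd G Z).card : ℝ) ≤ m ∧
    t ∈ closedNbhd G Z

theorem IsBroom.mono {V : Type*} [Fintype V] {G : SimpleGraph V} {m : ℝ} {Q T T' : Finset V}
    (h : IsBroom G m Q T) (hT : T' ⊆ T) : IsBroom G m Q T' :=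
  let ⟨z, hz⟩ := h
  ⟨z, fun t ht => hz t (hT ht)⟩

/-- A broom inside `S` that covers at least half of one of the sets `B i`, but not too much of
the others. -/
theorem IsCoherent.exists_broom {V : Type*} [Fintype V] {G : SimpleGraph V} {ε m : ℝ}
    (hG : IsCoherent G ε) {S : Finset V} {z : V}
    (hz : ε * Fintype.card V ≤ ((S.filter (SmallJoined G m S z)).card : ℝ))
    {ι : Type*} {I : Finset ι} (hI : I.Nonempty) {B : ι → Finset V}
    (hB1 : ∀ i ∈ I, 2 * (ε * Fintype.card V) ≤ (B i).card)
    (hB2 : ∀ i ∈ I, 4 * m ≤ (B i).card) (hB3 : ∀ i ∈ I, (B i).Nonempty) :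
    ∃ Q ⊆ S, Q.Nonempty ∧ ∃ j ∈ I, ((B j).card : ℝ) / 2 ≤ ((B j ∩ closedNbhd G Q).card : ℝ) ∧
      IsBroom G m Q (B j ∩ closedNbhd G Q) ∧
      ∀ i ∈ I, ((B i).card : ℝ) / 4 ≤ ((B i \ closedNbhd G Q).card : ℝ) := by
  set R := S.filter (SmallJoined G m S z) with hR
  have hex : ∀ s, ∃ Z : Finset V, s ∈ R → Z ⊆ S ∧ CutConnected G Z ∧ z ∈ Z ∧ s ∈ Z ∧
      ((closedNbhd G Z).card : ℝ) ≤ m := by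
    intro s
    by_cases hs : s ∈ R
    · obtain ⟨Z, h⟩ := (Finset.mem_filter.1 hs).2
      exact ⟨Z, fun _ => h⟩
    · exact ⟨∅, fun h => absurd h hs⟩
  choose Z hZ using hex
  let F : Finset (Finset V) := R.powerset.filter fun Y =>
    ∃ j ∈ I, ((B j).card : ℝ) / 2 ≤ ((B j ∩ closedNbhd G (Y.biUnion Z)).card : ℝ)
  have hRF : R ∈ F := by
    simp only [F, Finset.mem_filter, Finset.mem_powerset]
    obtain ⟨j, hj⟩ := hI
    refine ⟨subset_rfl, j, hj, ?_⟩
    have hsub : R ⊆ R.biUnion Z := fun s hs =>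
      Finset.mem_biUnion.2 ⟨s, hs, (hZ s hs).2.2.2.1⟩
    have h1 : ε * Fintype.card V ≤ ((R.biUnion Z).card : ℝ) :=
      hz.trans (by exact_mod_cast Finset.card_le_card hsub)
    have h2 := hG.card_sdiff_closedNbhd_lt h1 (B j)
    have h3 : ((B j ∩ closedNbhd G (R.biUnion Z)).card : ℝ) +
        (B j \ closedNbhd G (R.biUnion Z)).card = (B j).card := by
      exact_mod_cast Finset.card_inter_add_card_sdiff _ _
    have := hB1 j hj
    linarith
  obtain ⟨Y, hY, hmin⟩ := Finset.exists_min_image F Finset.card ⟨R, hRF⟩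
  simp only [F, Finset.mem_filter, Finset.mem_powerset] at hY hmin
  obtain ⟨hYR, j, hj, hYj⟩ := hY
  have hYne : Y.Nonempty := by
    by_contra hne
    rw [Finset.not_nonempty_iff_eq_empty] at hne
    subst hne
    have : (0 : ℝ) < (B j).card := by exact_mod_cast Finset.card_pos.2 (hB3 j hj)
    have hem : closedNbhd G (Finset.biUnion ∅ Z) = ∅ := by
      ext x; simp [mem_closedNbhd]
    rw [hem] at hYj
    simp at hYj
    linarith
  obtain ⟨y, hy⟩ := hYne
  refine ⟨Y.biUnion Z, Finset.biUnion_subset.2 fun s hs => (hZ s (hYR hs)).1,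
    ⟨z, Finset.mem_biUnion.2 ⟨y, hy, (hZ y (hYR hy)).2.2.1⟩⟩, j, hj, hYj, ⟨z, ?_⟩, ?_⟩
  · intro t ht
    have := (Finset.mem_inter.1 ht).2
    rw [closedNbhd_biUnion, Finset.mem_biUnion] at this
    obtain ⟨s, hs, hts⟩ := this
    obtain ⟨h1, h2, h3, h4, h5⟩ := hZ s (hYR hs)
    exact ⟨Z s, Finset.subset_biUnion_of_mem Z hs, h2, h3, h5, hts⟩
  · intro i hi
    have hlt : ((B i ∩ closedNbhd G ((Y.erase y).biUnion Z)).card : ℝ) < (B i).card / 2 := by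
      by_contra! hge
      have := hmin (Y.erase y) ⟨(Finset.erase_subset _ _).trans hYR, i, hi, hge⟩
      rw [Finset.card_erase_of_mem hy] at this
      have := Finset.card_pos.2 ⟨y, hy⟩
      omega
    have hsub : B i ∩ closedNbhd G (Y.biUnion Z) ⊆
        (B i ∩ closedNbhd G ((Y.erase y).biUnion Z)) ∪ closedNbhd G (Z y) := by
      intro x hx
      rw [Finset.mem_inter, ← Finset.insert_erase hy, Finset.biUnion_insert, closedNbhd_union,
        Finset.mem_union] at hx
      rw [Finset.mem_union, Finset.mem_inter]
      tauto
    have h1 : ((B i ∩ closedNbhd G (Y.biUnion Z)).card : ℝ) ≤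
        (B i ∩ closedNbhd G ((Y.erase y).biUnion Z)).card + (closedNbhd G (Z y)).card := by
      exact_mod_cast (Finset.card_le_card hsub).trans (Finset.card_union_le _ _)
    have h2 := (hZ y (hYR hy)).2.2.2.2
    have h3 : ((B i ∩ closedNbhd G (Y.biUnion Z)).card : ℝ) +
        (B i \ closedNbhd G (Y.biUnion Z)).card = (B i).card := by
      exact_mod_cast Finset.card_inter_add_card_sdiff _ _
    have := hB2 i hi
    linarith

end

section
open scoped Classical

/-- If every large set contains a vertex joined inside it to many others, then many pairwise
anticomplete brooms can be grown onto a common large set. -/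
theorem IsCoherent.exists_brooms_of_blocks {V : Type*} [Fintype V] [Nonempty V]
    {G : SimpleGraph V} {ε κ m : ℝ}
    (hG : IsCoherent G ε) (hεκ : 2 * ε ≤ κ) (hm : m ≤ κ * Fintype.card V)
    (hT : ∀ S : Finset V, κ * Fintype.card V ≤ S.card →
      ∃ z, ε * Fintype.card V ≤ ((S.filter (SmallJoined G m S z)).card : ℝ))
    {ι : Type*} (L k : ℕ) : ∀ (I : Finset ι) (B : ι → Finset V) (Λ : ι → Finset (Finset V)),
      I.card = k → I.Nonempty →
      (∀ i ∈ I, 4 ^ k * (κ * Fintype.card V) ≤ ((B i).card : ℝ)) →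
      (∀ i ∈ I, ∀ j ∈ I, i ≠ j → Disjoint (B i) (B j)) →
      (∀ i ∈ I, ∀ Q ∈ Λ i, IsBroom G m Q (B i) ∧ Disjoint Q (B i)) →
      (∀ i ∈ I, ∀ j ∈ I, i ≠ j → ∀ Q ∈ Λ i, Anticomplete G Q (B j)) →
      (∀ i ∈ I, ∀ Q ∈ Λ i, ∀ Q' ∈ Λ i, Q ≠ Q' → Anticomplete G Q Q') →
      2 ^ L ≤ ∑ i ∈ I, 2 ^ (Λ i).card →
      ∃ (T : Finset V) (Θ : Finset (Finset V)), κ * Fintype.card V ≤ (T.card : ℝ) ∧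
        L ≤ Θ.card ∧ (∀ Q ∈ Θ, IsBroom G m Q T ∧ Disjoint Q T) ∧
        ∀ Q ∈ Θ, ∀ Q' ∈ Θ, Q ≠ Q' → Anticomplete G Q Q' := by
  have hN := hG.one_le
  have hV : (0 : ℝ) < Fintype.card V := by exact_mod_cast Fintype.card_pos
  have hκN : 2 * (ε * Fintype.card V) ≤ κ * Fintype.card V := by nlinarith
  induction k with
  | zero =>
    intro I B Λ hIk hI
    rw [Finset.card_eq_zero] at hIk
    simp [hIk] at hI
  | succ k ih =>
    intro I B Λ hIk hI hB hdisj hbr hanti hpair hpot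
    have hBbig : ∀ i ∈ I, 4 * (κ * Fintype.card V) ≤ ((B i).card : ℝ) := fun i hi => by
      refine le_trans ?_ (hB i hi)
      have : (1 : ℝ) ≤ 4 ^ k := one_le_pow₀ (by norm_num)
      rw [pow_succ]
      nlinarith
    obtain ⟨i₀, hi₀, hmin⟩ := Finset.exists_min_image I (fun i => (Λ i).card) hI
    set J := I.erase i₀ with hJ
    have hJk : J.card = k := by rw [hJ, Finset.card_erase_of_mem hi₀]; omega
    by_cases hJne : J.Nonempty
    swap
    · rw [Finset.not_nonempty_iff_eq_empty] at hJne
      have hI1 : I = {i₀} := by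
        rw [← Finset.insert_erase hi₀, ← hJ, hJne]; rfl
      refine ⟨B i₀, Λ i₀, ?_, ?_, hbr i₀ hi₀, hpair i₀ hi₀⟩
      · have := hBbig i₀ hi₀
        linarith
      · rw [hI1, Finset.sum_singleton] at hpot
        exact (Nat.pow_le_pow_iff_right (by norm_num)).1 hpot
    have hJI : ∀ i ∈ J, i ∈ I := fun i hi => Finset.mem_of_mem_erase hi
    have hJi₀ : ∀ i ∈ J, i ≠ i₀ := fun i hi => Finset.ne_of_mem_erase hi
    obtain ⟨z, hz⟩ := hT (B i₀) (by have := hBbig i₀ hi₀; linarith)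
    obtain ⟨Q, hQ, hQne, j, hj, hhalf, hQbr, hquarter⟩ := hG.exists_broom hz hJne
      (fun i hi => by have := hBbig i (hJI i hi); linarith)
      (fun i hi => by have := hBbig i (hJI i hi); linarith)
      (fun i hi => by
        rw [← Finset.card_pos]
        have h1 := hBbig i (hJI i hi)
        have h2 : (0 : ℝ) < (B i).card := by linarith
        exact_mod_cast h2)
    have hQdisj : ∀ i ∈ J, Disjoint Q (B i) := fun i hi =>
      (hdisj i₀ hi₀ i (hJI i hi) (hJi₀ i hi).symm).mono_left hQ
    have hΛQ : ∀ i ∈ J, ∀ P ∈ Λ i, Anticomplete G P Q := fun i hi P hP =>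
      (hanti i (hJI i hi) i₀ hi₀ (hJi₀ i hi) P hP).mono subset_rfl hQ
    have hQΛ : Q ∉ Λ j := fun h => by
      obtain ⟨q, hq⟩ := hQne
      exact (hΛQ j hj Q h q hq q hq).1 rfl
    let B' : ι → Finset V := fun i =>
      if i = j then B i ∩ closedNbhd G Q else B i \ closedNbhd G Q
    let Λ' : ι → Finset (Finset V) := fun i => if i = j then insert Q (Λ i) else Λ i
    have hB'j : B' j = B j ∩ closedNbhd G Q := if_pos rfl
    have hB'i : ∀ i, i ≠ j → B' i = B i \ closedNbhd G Q := fun i hi => if_neg hi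
    have hΛ'j : Λ' j = insert Q (Λ j) := if_pos rfl
    have hΛ'i : ∀ i, i ≠ j → Λ' i = Λ i := fun i hi => if_neg hi
    have hB'B : ∀ i, B' i ⊆ B i := fun i => by
      by_cases hi : i = j
      · subst hi; rw [hB'j]; exact Finset.inter_subset_left
      · rw [hB'i i hi]; exact Finset.sdiff_subset
    have hmemΛ' : ∀ i, ∀ P ∈ Λ' i, P ∈ Λ i ∨ (P = Q ∧ i = j) := fun i P hP => by
      by_cases hi : i = j
      · subst hi
        rw [hΛ'j, Finset.mem_insert] at hP
        tauto
      · rw [hΛ'i i hi] at hP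
        exact Or.inl hP
    refine ih J B' Λ' hJk hJne ?_ ?_ ?_ ?_ ?_ ?_
    · intro i hi
      have h1 := hB i (hJI i hi)
      have h2 : ((B i).card : ℝ) / 4 ≤ (B' i).card := by
        by_cases hij : i = j
        · subst hij
          rw [hB'j]
          have : (0 : ℝ) ≤ (B i).card := Nat.cast_nonneg _
          linarith
        · rw [hB'i i hij]
          exact hquarter i hi
      rw [pow_succ] at h1
      linarith
    · intro i hi i' hi' hne
      exact (hdisj i (hJI i hi) i' (hJI i' hi') hne).mono (hB'B i) (hB'B i')
    · intro i hi P hP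
      rcases hmemΛ' i P hP with hP | ⟨rfl, rfl⟩
      · have := hbr i (hJI i hi) P hP
        exact ⟨this.1.mono (hB'B i), this.2.mono_right (hB'B i)⟩
      · rw [hB'j]
        exact ⟨hQbr, (hQdisj i hj).mono_right Finset.inter_subset_left⟩
    · intro i hi i' hi' hne P hP
      rcases hmemΛ' i P hP with hP | ⟨rfl, rfl⟩
      · exact (hanti i (hJI i hi) i' (hJI i' hi') hne P hP).mono subset_rfl (hB'B i')
      · rw [hB'i i' hne.symm]
        exact anticomplete_of_disjoint_closedNbhd fun x hx => (Finset.mem_sdiff.1 hx).2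
    · intro i hi P hP P' hP' hne
      rcases hmemΛ' i P hP with hP1 | ⟨rfl, rfl⟩
      · rcases hmemΛ' i P' hP' with hP'' | ⟨rfl, rfl⟩
        · exact hpair i (hJI i hi) P hP1 P' hP'' hne
        · exact hΛQ i hi P hP1
      · rcases hmemΛ' i P' hP' with hP'' | ⟨rfl, -⟩
        · exact (hΛQ i hi P' hP'').symm
        · exact absurd rfl hne
    · rw [← Finset.add_sum_erase I _ hi₀, ← hJ, ← Finset.add_sum_erase J _ hj] at hpot
      rw [← Finset.add_sum_erase J _ hj]
      have h1 : (Λ' j).card = (Λ j).card + 1 := by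
        rw [hΛ'j, Finset.card_insert_of_notMem hQΛ]
      have h2 : ∑ i ∈ J.erase j, 2 ^ (Λ' i).card = ∑ i ∈ J.erase j, 2 ^ (Λ i).card :=
        Finset.sum_congr rfl fun i hi => by rw [hΛ'i i (Finset.ne_of_mem_erase hi)]
      have h3 : 2 ^ (Λ i₀).card ≤ 2 ^ (Λ j).card :=
        Nat.pow_le_pow_right (by norm_num) (hmin j (hJI j hj))
      rw [h1, h2, pow_succ]
      omega

/-- A finite set can be split into `K` pairwise disjoint sets of size `s` when it has at least
`K * s` elements. -/
theorem Finset.exists_disjoint_blocks {V : Type*} (s : ℕ) (K : ℕ) : ∀ X : Finset V,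
    K * s ≤ X.card → ∃ B : ℕ → Finset V, (∀ i < K, B i ⊆ X ∧ (B i).card = s) ∧
      ∀ i < K, ∀ j < K, i ≠ j → Disjoint (B i) (B j) := by
  induction K with
  | zero => exact fun X _ => ⟨fun _ => ∅, by simp⟩
  | succ K ih =>
    intro X hX
    obtain ⟨A, hAX, hA⟩ := Finset.exists_subset_card_eq (s := X) (n := s) (by nlinarith)
    obtain ⟨B, hB1, hB2⟩ := ih (X \ A) (by
      have := Finset.card_sdiff_add_card_eq_card hAX
      rw [add_mul] at hX
      omega)
    have hdis : ∀ i < K, Disjoint (B i) A := fun i hi =>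
      Finset.sdiff_disjoint.mono_left (hB1 i hi).1
    refine ⟨fun i => if i < K then B i else A, fun i hi => ?_, fun i hi j hj hij => ?_⟩
    · by_cases h : i < K
      · simp only [if_pos h]
        exact ⟨(hB1 i h).1.trans Finset.sdiff_subset, (hB1 i h).2⟩
      · simp only [if_neg h]
        exact ⟨hAX, hA⟩
    · by_cases h : i < K <;> by_cases h' : j < K
      · simp only [if_pos h, if_pos h']
        exact hB2 i h j h' hij
      · simp only [if_pos h, if_neg h']
        exact hdis i h
      · simp only [if_neg h, if_pos h']
        exact (hdis j h').symm
      · omega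

theorem IsCoherent.exists_brooms {V : Type*} [Fintype V] [Nonempty V]
    {G : SimpleGraph V} {ε κ m : ℝ} (L : ℕ)
    (hG : IsCoherent G ε) (hεκ : 2 * ε ≤ κ) (hm : m ≤ κ * Fintype.card V)
    (hκ : 2 * 2 ^ L * 4 ^ (2 ^ L) * κ ≤ 1)
    (hT : ∀ S : Finset V, κ * Fintype.card V ≤ S.card →
      ∃ z, ε * Fintype.card V ≤ ((S.filter (SmallJoined G m S z)).card : ℝ)) :
    ∃ (T : Finset V) (Θ : Finset (Finset V)), κ * Fintype.card V ≤ (T.card : ℝ) ∧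
      L ≤ Θ.card ∧ (∀ Q ∈ Θ, IsBroom G m Q T ∧ Disjoint Q T) ∧
      ∀ Q ∈ Θ, ∀ Q' ∈ Θ, Q ≠ Q' → Anticomplete G Q Q' := by
  have hN := hG.one_le
  set K := 2 ^ L with hK
  have hV : (0 : ℝ) < Fintype.card V := by exact_mod_cast Fintype.card_pos
  have hκN : 2 * (ε * Fintype.card V) ≤ κ * Fintype.card V := by nlinarith
  set x : ℝ := 4 ^ K * (κ * Fintype.card V) with hx
  have h4 : (1 : ℝ) ≤ 4 ^ K := one_le_pow₀ (by norm_num)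
  have hx1 : 1 ≤ x := by nlinarith
  have hKx : 2 * (K : ℝ) * x ≤ Fintype.card V := by
    have : 2 * (K : ℝ) * x = (2 * 2 ^ L * 4 ^ K * κ) * Fintype.card V := by
      rw [hx, hK]; push_cast; ring
    rw [this]
    nlinarith
  obtain ⟨B, hB1, hB2⟩ := Finset.exists_disjoint_blocks (V := V) ⌈x⌉₊ K Finset.univ (by
    have h1 : (⌈x⌉₊ : ℝ) < x + 1 := Nat.ceil_lt_add_one (by linarith)
    have h2 : (K : ℝ) * ⌈x⌉₊ ≤ K * (2 * x) :=
      mul_le_mul_of_nonneg_left (by linarith) (Nat.cast_nonneg _)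
    have h3 : (K : ℝ) * ⌈x⌉₊ ≤ Fintype.card V := by linarith
    rw [Finset.card_univ]
    exact_mod_cast h3)
  refine hG.exists_brooms_of_blocks hεκ hm hT L K (Finset.range K) B (fun _ => ∅) (by simp)
    (by simp [hK]) ?_ ?_ (by simp) (by simp) (by simp) (by simp [hK])
  · intro i hi
    rw [(hB1 i (Finset.mem_range.1 hi)).2]
    exact Nat.le_ceil x
  · intro i hi j hj
    exact hB2 i (Finset.mem_range.1 hi) j (Finset.mem_range.1 hj)

/-- A digraph of small maximum out-degree has a large independent set. -/
theorem Finset.exists_independent_of_outdegree {V : Type*} (out : V → Finset V) (Δ h : ℕ) :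
    ∀ T : Finset V, (∀ t ∈ T, (out t).card ≤ Δ) → h * (2 * Δ + 1) ≤ T.card →
      ∃ S ⊆ T, S.card = h ∧ ∀ s ∈ S, ∀ t ∈ S, s ≠ t → t ∉ out s := by
  induction h with
  | zero => exact fun T _ _ => ⟨∅, by simp⟩
  | succ h ih =>
    intro T hout hT
    have hTne : T.Nonempty := by
      rw [← Finset.card_pos]
      nlinarith
    obtain ⟨t, ht, hin⟩ : ∃ t ∈ T, (T.filter fun s => t ∈ out s).card ≤ Δ := by
      by_contra! hcon
      have h1 : ∑ t ∈ T, (T.filter fun s => t ∈ out s).card =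
          ∑ s ∈ T, (T.filter fun t => t ∈ out s).card :=
        Finset.sum_card_bipartiteAbove_eq_sum_card_bipartiteBelow (fun t s => t ∈ out s)
      have h2 : ∑ s ∈ T, (T.filter fun t => t ∈ out s).card ≤ ∑ s ∈ T, Δ :=
        Finset.sum_le_sum fun s hs => (Finset.card_le_card fun x hx =>
          (Finset.mem_filter.1 hx).2).trans (hout s hs)
      have h3 : ∑ t ∈ T, Δ < ∑ t ∈ T, (T.filter fun s => t ∈ out s).card :=
        Finset.sum_lt_sum_of_nonempty hTne hcon
      omega
    set bad := insert t (out t ∪ T.filter fun s => t ∈ out s) with hbad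
    have hbadc : bad.card ≤ 2 * Δ + 1 := by
      have h1 := Finset.card_insert_le t (out t ∪ T.filter fun s => t ∈ out s)
      have h2 := Finset.card_union_le (out t) (T.filter fun s => t ∈ out s)
      have h3 := hout t ht
      rw [hbad]
      omega
    obtain ⟨S, hS, hSc, hSi⟩ := ih (T \ bad) (fun s hs => hout s (Finset.mem_sdiff.1 hs).1) (by
      have := Finset.le_card_sdiff bad T
      rw [add_mul] at hT
      omega)
    have hSt : ∀ s ∈ S, s ∈ T ∧ s ≠ t ∧ s ∉ out t ∧ t ∉ out s := fun s hs => by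
      have := hS hs
      simp only [hbad, Finset.mem_sdiff, Finset.mem_insert, Finset.mem_union,
        Finset.mem_filter] at this
      tauto
    refine ⟨insert t S, ?_, ?_, ?_⟩
    · exact Finset.insert_subset ht fun s hs => (hSt s hs).1
    · rw [Finset.card_insert_of_notMem fun h => (hSt t h).2.1 rfl, hSc]
    · intro a ha b hb hab
      rcases Finset.mem_insert.1 ha with rfl | ha' <;>
        rcases Finset.mem_insert.1 hb with rfl | hb'
      · exact absurd rfl hab
      · exact (hSt b hb').2.2.1
      · exact (hSt a ha').2.2.2
      · exact hSi a ha' b hb' hab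

/-- Many pairwise anticomplete brooms onto a large set yield a template. -/
theorem IsCoherent.nonempty_template_of_brooms {V : Type*} [Fintype V]
    {G : SimpleGraph V} {ε m : ℝ} (hG : IsCoherent G ε) {U : Type*} [Fintype U]
    (H : SimpleGraph U) {T : Finset V} {Θ : Finset (Finset V)}
    (hΘ : H.edgeFinset.card ≤ Θ.card) (hbr : ∀ Q ∈ Θ, IsBroom G m Q T ∧ Disjoint Q T)
    (hanti : ∀ Q ∈ Θ, ∀ Q' ∈ Θ, Q ≠ Q' → Anticomplete G Q Q') (hTne : T.Nonempty)
    (hT : Fintype.card U * (2 * (H.edgeFinset.card * m + ε * Fintype.card V) + 1) ≤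
      (T.card : ℝ)) : Nonempty (SubdivisionTemplate G H) := by
  obtain ⟨φ⟩ : Nonempty (H.edgeFinset ↪ Θ) :=
    Function.Embedding.nonempty_of_card_le (by
      rwa [Fintype.card_coe, Fintype.card_coe])
  have hq : ∀ e : Sym2 U, ∃ Q : Finset V, ∀ he : e ∈ H.edgeFinset, Q = φ ⟨e, he⟩ := fun e => by
    by_cases he : e ∈ H.edgeFinset
    · exact ⟨φ ⟨e, he⟩, fun _ => rfl⟩
    · exact ⟨∅, fun h => absurd h he⟩
  choose q hq using hq
  have hqΘ : ∀ e ∈ H.edgeFinset, q e ∈ Θ := fun e he => by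
    rw [hq e he]; exact (φ ⟨e, he⟩).2
  have hqinj : ∀ e ∈ H.edgeFinset, ∀ f ∈ H.edgeFinset, e ≠ f → q e ≠ q f := by
    intro e he f hf hne heq
    rw [hq e he, hq f hf] at heq
    exact hne (congrArg Subtype.val (φ.injective (Subtype.ext heq)))
  have hz : ∀ e : Sym2 U, ∃ z : V, ∃ Z : V → Finset V, ∀ t ∈ T, e ∈ H.edgeFinset →
      Z t ⊆ q e ∧ CutConnected G (Z t) ∧ z ∈ Z t ∧ ((closedNbhd G (Z t)).card : ℝ) ≤ m ∧
        t ∈ closedNbhd G (Z t) := by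
    intro e
    by_cases he : e ∈ H.edgeFinset
    · obtain ⟨z, hz⟩ := (hbr _ (hqΘ e he)).1
      have : ∀ t, ∃ Z : Finset V, t ∈ T → Z ⊆ q e ∧ CutConnected G Z ∧ z ∈ Z ∧
          ((closedNbhd G Z).card : ℝ) ≤ m ∧ t ∈ closedNbhd G Z := fun t => by
        by_cases ht : t ∈ T
        · obtain ⟨Z, hZ⟩ := hz t ht
          exact ⟨Z, fun _ => hZ⟩
        · exact ⟨∅, fun h => absurd h ht⟩
      choose Z hZ using this
      exact ⟨z, Z, fun t ht _ => hZ t ht⟩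
    · exact ⟨hTne.choose, fun _ => ∅, fun _ _ h => absurd h he⟩
  choose z Z hZ using hz
  let out : V → Finset V := fun t =>
    (H.edgeFinset.biUnion fun e => closedNbhd G (Z e t)) ∪ closedNbhd G {t}
  have hout : ∀ t ∈ T, ((out t).card : ℝ) ≤ H.edgeFinset.card * m + ε * Fintype.card V := by
    intro t ht
    have h1 : ((out t).card : ℝ) ≤ ∑ e ∈ H.edgeFinset, ((closedNbhd G (Z e t)).card : ℝ) +
        (closedNbhd G {t}).card := by
      exact_mod_cast (Finset.card_union_le _ _).trans
        (Nat.add_le_add_right Finset.card_biUnion_le _)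
    have h2 : ∑ e ∈ H.edgeFinset, ((closedNbhd G (Z e t)).card : ℝ) ≤ H.edgeFinset.card * m := by
      rw [← nsmul_eq_mul]
      exact Finset.sum_le_card_nsmul _ _ _ fun e he => (hZ e t ht he).2.2.2.1
    have := hG.card_closedNbhd_le t
    linarith
  set D : ℝ := H.edgeFinset.card * m + ε * Fintype.card V with hD
  obtain ⟨S, hST, hSc, hS⟩ := Finset.exists_independent_of_outdegree out ⌊D⌋₊ (Fintype.card U) T
    (fun t ht => Nat.le_floor (hout t ht)) (by
      obtain ⟨t, ht⟩ := hTne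
      have hD0 : 0 ≤ D := le_trans (Nat.cast_nonneg _) (hout t ht)
      have h1 := Nat.floor_le hD0
      have h2 : (Fintype.card U : ℝ) * (2 * ⌊D⌋₊ + 1) ≤ T.card :=
        le_trans (mul_le_mul_of_nonneg_left (by linarith) (Nat.cast_nonneg _)) hT
      exact_mod_cast h2)
  obtain ⟨ψ⟩ : Nonempty (U ≃ S) := by
    rw [← Fintype.card_eq]; simp [hSc]
  have hψT : ∀ u, (ψ u : V) ∈ T := fun u => hST (ψ u).2
  have hψout : ∀ u w, u ≠ w → (ψ w : V) ∉ out (ψ u) := fun u w huw =>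
    hS _ (ψ u).2 _ (ψ w).2 fun h => huw (ψ.injective (Subtype.ext h))
  have hlink : ∀ e ∈ H.edgeSet, ∀ a ∈ (Finset.univ.filter (· ∈ e)).biUnion
      (fun u => Z e (ψ u)), a ∈ q e := by
    intro e he a ha
    rw [← SimpleGraph.mem_edgeFinset] at he
    obtain ⟨u, -, ha⟩ := Finset.mem_biUnion.1 ha
    exact (hZ e _ (hψT u) he).1 ha
  refine ⟨⟨fun u => ψ u, fun u w h => ψ.injective (Subtype.ext h), fun u w huw => ?_,
    fun e => (Finset.univ.filter (· ∈ e)).biUnion fun u => Z e (ψ u),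
    fun e he => ?_, fun e he u hu => ?_, fun e he u hu => ?_, fun e he u hu a ha hua => ?_,
    fun e he f hf hef a ha b hb => ?_⟩⟩
  · rcases eq_or_ne u w with rfl | hne
    · exact G.loopless.irrefl _ huw
    · refine hψout u w hne (Finset.mem_union_right _ ?_)
      exact mem_closedNbhd_singleton.2 (Or.inr huw)
  · rw [← SimpleGraph.mem_edgeFinset] at he
    refine CutConnected.biUnion (z := z e) ?_ (fun u _ => (hZ e _ (hψT u) he).2.1)
      (fun u _ => (hZ e _ (hψT u) he).2.2.1)
    induction e with
    | _ x y => exact ⟨x, by simp⟩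
  · have he' := SimpleGraph.mem_edgeFinset.2 he
    have h1 := hZ e _ (hψT u) he'
    rcases mem_closedNbhd.1 h1.2.2.2.2 with h2 | ⟨a, ha, hau⟩
    · exact absurd (hψT u) (Finset.disjoint_left.1 (hbr _ (hqΘ e he')).2 (h1.1 h2))
    · exact ⟨a, Finset.mem_biUnion.2 ⟨u, by simpa using hu, ha⟩, hau.symm⟩
  · exact Finset.disjoint_left.1 (hbr _ (hqΘ e (SimpleGraph.mem_edgeFinset.2 he))).2
      (hlink e he _ hu) (hψT u)
  · obtain ⟨w, hw, ha⟩ := Finset.mem_biUnion.1 ha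
    have hw : w ∈ e := by simpa using hw
    refine hψout w u (fun h => hu (h ▸ hw)) (Finset.mem_union_left _ (Finset.mem_biUnion.2
      ⟨e, SimpleGraph.mem_edgeFinset.2 he, mem_closedNbhd.2 (Or.inr ⟨a, ha, hua.symm⟩)⟩))
  · have he' := SimpleGraph.mem_edgeFinset.2 he
    have hf' := SimpleGraph.mem_edgeFinset.2 hf
    exact hanti _ (hqΘ e he') _ (hqΘ f hf') (hqinj e he' f hf' hef) a (hlink e he a ha) b
      (hlink f hf b hb)

end

section
open scoped Classical

theorem SmallJoined.symm {V : Type*} [Fintype V] {G : SimpleGraph V} {m : ℝ} {S : Finset V}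
    {y z : V} (h : SmallJoined G m S y z) : SmallJoined G m S z y :=
  let ⟨Z, h1, h2, h3, h4, h5⟩ := h
  ⟨Z, h1, h2, h4, h3, h5⟩

theorem anticomplete_of_not_smallJoined {V : Type*} [Fintype V] {G : SimpleGraph V} {m : ℝ}
    {S Y Z : Finset V} {y z : V} (h : ¬ SmallJoined G m S y z)
    (hYS : Y ⊆ S) (hZS : Z ⊆ S) (hY : CutConnected G Y) (hZ : CutConnected G Z)
    (hy : y ∈ Y) (hz : z ∈ Z) (hYm : ((closedNbhd G Y).card : ℝ) ≤ m / 2)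
    (hZm : ((closedNbhd G Z).card : ℝ) ≤ m / 2) : Anticomplete G Y Z := by
  intro a ha b hb
  by_contra hcon
  refine h ⟨Y ∪ Z, Finset.union_subset hYS hZS, hY.union hZ ha hb (by tauto), by simp [hy],
    by simp [hz], ?_⟩
  have h1 : ((closedNbhd G (Y ∪ Z)).card : ℝ) ≤
      (closedNbhd G Y).card + (closedNbhd G Z).card := by
    rw [closedNbhd_union]
    exact_mod_cast Finset.card_union_le _ _
  linarith

/-- A connected set containing `z` whose outer boundary is large, but whose closed neighbourhood
is not too large. -/
theorem IsCoherent.exists_probe {V : Type*} [Fintype V] [Nonempty V] {G : SimpleGraph V}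
    {ε m : ℝ} (hG : IsCoherent G ε) {C : Finset V} (hC : CutConnected G C)
    (hCε : ε * Fintype.card V ≤ C.card) (hεm : 8 * (ε * Fintype.card V) ≤ m)
    (hm : 2 * m ≤ Fintype.card V) {z : V} (hz : z ∈ C) :
    ∃ P ⊆ C, CutConnected G P ∧ z ∈ P ∧ ((closedNbhd G P).card : ℝ) ≤ m / 2 ∧
      m / 8 ≤ ((closedNbhd G P \ P).card : ℝ) := by
  have h1 := hG.one_le
  let F : Finset (Finset V) := C.powerset.filter fun Z =>
    CutConnected G Z ∧ z ∈ Z ∧ ((closedNbhd G Z).card : ℝ) ≤ m / 2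
  have hF : {z} ∈ F := by
    simp only [F, Finset.mem_filter, Finset.mem_powerset]
    refine ⟨by simpa using hz, CutConnected.singleton z, by simp, ?_⟩
    have := hG.card_closedNbhd_le z
    linarith
  obtain ⟨Z, hZ, hmax⟩ := Finset.exists_max_image F Finset.card ⟨_, hF⟩
  simp only [F, Finset.mem_filter, Finset.mem_powerset] at hZ hmax
  obtain ⟨hZC, hZc, hzZ, hZm⟩ := hZ
  have hZε : (Z.card : ℝ) < ε * Fintype.card V := by
    by_contra! hge
    have h2 := hG.card_sdiff_closedNbhd_lt hge Finset.univ
    have h3 : ((Finset.univ \ closedNbhd G Z).card : ℝ) + (closedNbhd G Z).card =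
        Fintype.card V := by
      exact_mod_cast Finset.card_sdiff_add_card_eq_card (Finset.subset_univ _)
    linarith
  obtain ⟨a, ha, w, hwC, hwZ, haw⟩ := hC.exists_adj_of_ssubset hZC ⟨z, hzZ⟩ fun h => by
    rw [h] at hZε
    exact absurd hCε (not_le.2 hZε)
  refine ⟨Z, hZC, hZc, hzZ, hZm, ?_⟩
  have hbig : m / 2 < ((closedNbhd G (insert w Z)).card : ℝ) := by
    by_contra! hle
    have := hmax (insert w Z) ⟨Finset.insert_subset hwC hZC, hZc.insert ha haw.symm,
      by simp [hzZ], hle⟩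
    rw [Finset.card_insert_of_notMem hwZ] at this
    omega
  have h2 : ((closedNbhd G (insert w Z)).card : ℝ) ≤
      (closedNbhd G {w}).card + (closedNbhd G Z).card := by
    rw [Finset.insert_eq, closedNbhd_union]
    exact_mod_cast Finset.card_union_le _ _
  have h3 := hG.card_closedNbhd_le w
  have h4 : ((closedNbhd G Z \ Z).card : ℝ) + Z.card = (closedNbhd G Z).card := by
    exact_mod_cast Finset.card_sdiff_add_card_eq_card (subset_closedNbhd Z)
  linarith

theorem sum_sum_update {ι V : Type*} [Fintype ι] [Fintype V] (p : ι) (F : (ι → V) → ℝ) :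
    ∑ ω, ∑ a, F (Function.update ω p a) = Fintype.card V * ∑ ω, F ω := by
  let σ : (ι → V) × V → (ι → V) × V := fun x => (Function.update x.1 p x.2, x.1 p)
  have hσ : Function.Involutive σ := fun x => by simp [σ]
  calc ∑ ω, ∑ a, F (Function.update ω p a)
      = ∑ x : (ι → V) × V, F (σ x).1 := by rw [Fintype.sum_prod_type]
    _ = ∑ x : (ι → V) × V, F x.1 := Equiv.sum_comp hσ.toPerm fun x => F x.1
    _ = Fintype.card V * ∑ ω, F ω := by
        rw [Fintype.sum_prod_type, Finset.mul_sum]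
        simp

/-- The union of the closed neighbourhoods of the entries of `ω` other than the `p`-th
and `q`-th. -/
noncomputable def nbhdExcept {V ι : Type*} [Fintype V] [Fintype ι] (G : SimpleGraph V) (p q : ι)
    (ω : ι → V) : Finset V :=
  (Finset.univ.filter fun k => k ≠ p ∧ k ≠ q).biUnion fun k => closedNbhd G {ω k}

/-- The elements of `C D` whose set `A D z` contains the `p`-th and `q`-th entry of `ω`, where
`D` comes from the other entries. -/
noncomputable def doubleHits {V ι : Type*} [Fintype V] [Fintype ι] (G : SimpleGraph V)
    (C : Finset V → Finset V) (A : Finset V → V → Finset V) (p q : ι) (ω : ι → V) : Finset V :=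
  (C (nbhdExcept G p q ω)).filter fun z =>
    ω p ∈ A (nbhdExcept G p q ω) z ∧ ω q ∈ A (nbhdExcept G p q ω) z

section
variable {V ι : Type*} [Fintype V] [Fintype ι] {G : SimpleGraph V}

theorem mem_nbhdExcept {p q k : ι} {ω : ι → V} {y : V} (hp : k ≠ p) (hq : k ≠ q)
    (hy : y ∈ closedNbhd G {ω k}) : y ∈ nbhdExcept G p q ω :=
  Finset.mem_biUnion.2 ⟨k, Finset.mem_filter.2 ⟨Finset.mem_univ _, hp, hq⟩, hy⟩

theorem nbhdExcept_update (p q : ι) (ω : ι → V) (a b : V) :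
    nbhdExcept G p q (Function.update (Function.update ω q b) p a) = nbhdExcept G p q ω := by
  unfold nbhdExcept
  refine Finset.biUnion_congr rfl fun k hk => ?_
  rw [Finset.mem_filter] at hk
  rw [Function.update_of_ne hk.2.1, Function.update_of_ne hk.2.2]

theorem IsCoherent.card_nbhdExcept_le {ε : ℝ} (hG : IsCoherent G ε) (hε : 0 ≤ ε) (p q : ι)
    (ω : ι → V) : ((nbhdExcept G p q ω).card : ℝ) ≤ Fintype.card ι * (ε * Fintype.card V) := by
  have h1 : ((nbhdExcept G p q ω).card : ℝ) ≤
      ∑ k ∈ Finset.univ.filter fun k => k ≠ p ∧ k ≠ q, ((closedNbhd G {ω k}).card : ℝ) := by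
    exact_mod_cast Finset.card_biUnion_le
  refine h1.trans ((Finset.sum_le_card_nsmul _ _ _ fun k _ => hG.card_closedNbhd_le (ω k)).trans ?_)
  rw [nsmul_eq_mul]
  refine mul_le_mul_of_nonneg_right ?_ (by positivity)
  exact_mod_cast Finset.card_le_univ _

theorem sum_card_doubleHits_ge {C : Finset V → Finset V} {A : Finset V → V → Finset V}
    {p q : ι} (hpq : p ≠ q) {a b : ℝ} (hb : 0 ≤ b)
    (hC : ∀ ω : ι → V, a ≤ ((C (nbhdExcept G p q ω)).card : ℝ))
    (hA : ∀ ω : ι → V, ∀ z ∈ C (nbhdExcept G p q ω),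
      b ≤ ((A (nbhdExcept G p q ω) z).card : ℝ)) :
    (Fintype.card V : ℝ) ^ Fintype.card ι * (a * b ^ 2) ≤
      (Fintype.card V : ℝ) ^ 2 * ∑ ω, ((doubleHits G C A p q ω).card : ℝ) := by
  have h1 : (Fintype.card V : ℝ) ^ 2 * ∑ ω, ((doubleHits G C A p q ω).card : ℝ) =
      ∑ ω : ι → V, ∑ y, ∑ x, ((doubleHits G C A p q
        (Function.update (Function.update ω q y) p x)).card : ℝ) := by
    rw [sum_sum_update q fun ω => ∑ x, ((doubleHits G C A p q
        (Function.update ω p x)).card : ℝ),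
      sum_sum_update p fun ω => ((doubleHits G C A p q ω).card : ℝ)]
    ring
  have h2 : ∀ ω : ι → V, a * b ^ 2 ≤ ∑ y, ∑ x, ((doubleHits G C A p q
        (Function.update (Function.update ω q y) p x)).card : ℝ) := by
    intro ω
    set D := nbhdExcept G p q ω with hD
    have h3 : ∀ y x, ((doubleHits G C A p q
        (Function.update (Function.update ω q y) p x)).card : ℝ) =
        ∑ z ∈ C D, (if y ∈ A D z then (1 : ℝ) else 0) * (if x ∈ A D z then (1 : ℝ) else 0) := by
      intro y x
      rw [doubleHits, nbhdExcept_update, Function.update_self, Function.update_of_ne hpq.symm,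
        Function.update_self, ← hD, Finset.card_filter]
      push_cast
      refine Finset.sum_congr rfl fun z _ => ?_
      by_cases hy : y ∈ A D z <;> by_cases hx : x ∈ A D z <;> simp [hx, hy]
    have h4 : ∑ y, ∑ x, ((doubleHits G C A p q
        (Function.update (Function.update ω q y) p x)).card : ℝ) =
        ∑ z ∈ C D, ((A D z).card : ℝ) ^ 2 := by
      calc _ = ∑ y, ∑ x, ∑ z ∈ C D, (if y ∈ A D z then (1 : ℝ) else 0) *
            (if x ∈ A D z then (1 : ℝ) else 0) :=
            Finset.sum_congr rfl fun y _ => Finset.sum_congr rfl fun x _ => h3 y x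
        _ = ∑ y, ∑ z ∈ C D, ∑ x, (if y ∈ A D z then (1 : ℝ) else 0) *
            (if x ∈ A D z then (1 : ℝ) else 0) :=
            Finset.sum_congr rfl fun y _ => Finset.sum_comm
        _ = ∑ z ∈ C D, ∑ y, ∑ x, (if y ∈ A D z then (1 : ℝ) else 0) *
            (if x ∈ A D z then (1 : ℝ) else 0) := Finset.sum_comm
        _ = _ := by
            refine Finset.sum_congr rfl fun z _ => ?_
            rw [← Finset.sum_mul_sum, sq]
            simp
    rw [h4]
    calc a * b ^ 2 ≤ (C D).card * b ^ 2 :=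
          mul_le_mul_of_nonneg_right (hC ω) (by positivity)
      _ ≤ ∑ z ∈ C D, ((A D z).card : ℝ) ^ 2 := by
          rw [← nsmul_eq_mul]
          exact Finset.card_nsmul_le_sum _ _ _ fun z hz =>
            pow_le_pow_left₀ hb (hA ω z hz) 2
  rw [h1]
  calc (Fintype.card V : ℝ) ^ Fintype.card ι * (a * b ^ 2)
      = ∑ ω : ι → V, a * b ^ 2 := by simp
    _ ≤ _ := Finset.sum_le_sum fun ω _ => h2 ω

theorem IsCoherent.card_filter_mem_closedNbhd_le [Nonempty V] {ε : ℝ} (hG : IsCoherent G ε)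
    {p q : ι} (hpq : p ≠ q) :
    (((Finset.univ : Finset (ι → V)).filter fun ω => ω p ∈ closedNbhd G {ω q}).card : ℝ) ≤
      ε * (Fintype.card V : ℝ) ^ Fintype.card ι := by
  have hV : (0 : ℝ) < Fintype.card V := by exact_mod_cast Fintype.card_pos
  have h1 : (Fintype.card V : ℝ) *
      (((Finset.univ : Finset (ι → V)).filter fun ω => ω p ∈ closedNbhd G {ω q}).card : ℝ) =
      ∑ ω : ι → V, ((closedNbhd G {ω q}).card : ℝ) := by
    rw [Finset.card_filter]
    push_cast
    rw [← sum_sum_update p]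
    refine Finset.sum_congr rfl fun ω _ => ?_
    simp [Function.update_of_ne hpq.symm]
  have h2 : ∑ ω : ι → V, ((closedNbhd G {ω q}).card : ℝ) ≤
      (Fintype.card V : ℝ) ^ Fintype.card ι * (ε * Fintype.card V) := by
    refine (Finset.sum_le_card_nsmul _ _ _ fun ω _ => hG.card_closedNbhd_le (ω q)).trans ?_
    simp
  rw [← h1] at h2
  refine le_of_mul_le_mul_left (h2.trans_eq ?_) hV
  ring

end

/-- A selection `ω` of pairwise distant vertices with many double hits on average. -/
theorem IsCoherent.exists_selection {V ι : Type*} [Fintype V] [Nonempty V] [Fintype ι]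
    {G : SimpleGraph V} {ε : ℝ} (hG : IsCoherent G ε)
    {C : Finset V → Finset V} {A : Finset V → V → Finset V} {a b : ℝ} (hb : 0 ≤ b)
    {E : Finset (ι × ι)} (hE : ∀ e ∈ E, e.1 ≠ e.2) (hEne : E.Nonempty)
    (hC : ∀ p q, ∀ ω : ι → V, a * Fintype.card V ≤ ((C (nbhdExcept G p q ω)).card : ℝ))
    (hA : ∀ p q, ∀ ω : ι → V, ∀ z ∈ C (nbhdExcept G p q ω),
      b * Fintype.card V ≤ ((A (nbhdExcept G p q ω) z).card : ℝ))
    (hε : 2 * (Fintype.card ι : ℝ) ^ 2 * ε < a * b ^ 2) :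
    ∃ ω : ι → V, (∀ p q, p ≠ q → ω p ∉ closedNbhd G {ω q}) ∧
      a * b ^ 2 / 2 * (E.card * Fintype.card V) ≤
        ∑ e ∈ E, ((doubleHits G C A e.1 e.2 ω).card : ℝ) := by
  have hV : (0 : ℝ) < Fintype.card V := by exact_mod_cast Fintype.card_pos
  have hEpos : (0 : ℝ) < E.card := by exact_mod_cast Finset.card_pos.2 hEne
  by_contra! hcon
  set n : ℝ := (Fintype.card V : ℝ) with hn
  set k := Fintype.card ι with hk
  set X : (ι → V) → ℝ := fun ω => ∑ e ∈ E, ((doubleHits G C A e.1 e.2 ω).card : ℝ) with hX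
  let bad : Finset (ι → V) := Finset.univ.filter fun ω => ∃ p q, p ≠ q ∧ ω p ∈ closedNbhd G {ω q}
  have hXle : ∀ ω, X ω ≤ E.card * n := fun ω => by
    rw [← nsmul_eq_mul]
    exact Finset.sum_le_card_nsmul _ _ _ fun e _ => by
      rw [hn]; exact_mod_cast Finset.card_le_univ _
  have hlow : E.card * (n ^ k * (a * b ^ 2 * n)) ≤ ∑ ω, X ω := by
    rw [hX, Finset.sum_comm, ← nsmul_eq_mul]
    refine Finset.card_nsmul_le_sum _ _ _ fun e he => ?_
    have h1 := sum_card_doubleHits_ge (G := G) (hE e he) (mul_nonneg hb hV.le)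
      (hC e.1 e.2) (hA e.1 e.2)
    rw [← hn, ← hk] at h1
    have h2 : n ^ k * (a * n * (b * n) ^ 2) = n ^ 2 * (n ^ k * (a * b ^ 2 * n)) := by ring
    rw [h2] at h1
    exact le_of_mul_le_mul_left h1 (by positivity)
  have hbad : (bad.card : ℝ) ≤ k ^ 2 * (ε * n ^ k) := by
    have hsub : bad ⊆ (Finset.univ.filter fun x : ι × ι => x.1 ≠ x.2).biUnion fun x =>
        Finset.univ.filter fun ω => ω x.1 ∈ closedNbhd G {ω x.2} := by
      intro ω hω
      obtain ⟨p, q, hpq, h⟩ := (Finset.mem_filter.1 hω).2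
      exact Finset.mem_biUnion.2 ⟨(p, q), by simpa using hpq, by simpa using h⟩
    have h1 : (bad.card : ℝ) ≤ ∑ x ∈ Finset.univ.filter fun x : ι × ι => x.1 ≠ x.2,
        (((Finset.univ : Finset (ι → V)).filter fun ω =>
          ω x.1 ∈ closedNbhd G {ω x.2}).card : ℝ) := by
      exact_mod_cast (Finset.card_le_card hsub).trans Finset.card_biUnion_le
    refine h1.trans ((Finset.sum_le_card_nsmul _ _ (ε * n ^ k) fun x hx =>
      hG.card_filter_mem_closedNbhd_le (Finset.mem_filter.1 hx).2).trans ?_)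
    rw [nsmul_eq_mul]
    have hε0 : 0 ≤ ε * n ^ k := by
      have h := hG.one_le
      have : 0 < ε := by
        by_contra! hε0
        nlinarith
      positivity
    refine mul_le_mul_of_nonneg_right ?_ hε0
    have : (Finset.univ.filter fun x : ι × ι => x.1 ≠ x.2).card ≤ k ^ 2 := by
      refine (Finset.card_le_univ _).trans_eq ?_
      rw [Fintype.card_prod, sq]
    exact_mod_cast this
  have hup : ∑ ω, X ω ≤ bad.card * (E.card * n) + n ^ k * (a * b ^ 2 / 2 * (E.card * n)) := by
    rw [← Finset.sum_add_sum_compl bad X]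
    refine add_le_add ?_ ?_
    · rw [← nsmul_eq_mul]
      exact Finset.sum_le_card_nsmul _ _ _ fun ω _ => hXle ω
    · have hpos : 0 ≤ a * b ^ 2 / 2 * (E.card * n) := by
        have : 0 ≤ a * b ^ 2 := by
          have h := hG.one_le
          have : 0 < ε := by
            by_contra! hε0
            nlinarith
          exact le_trans (by positivity) hε.le
        positivity
      refine (Finset.sum_le_card_nsmul _ _ (a * b ^ 2 / 2 * (E.card * n)) fun ω hω => ?_).trans ?_
      · refine (hcon ω fun p q hpq h => ?_).le
        exact (Finset.mem_compl.1 hω) (Finset.mem_filter.2 ⟨Finset.mem_univ _, p, q, hpq, h⟩)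
      · rw [nsmul_eq_mul]
        refine mul_le_mul_of_nonneg_right ?_ hpos
        have : badᶜ.card ≤ Fintype.card V ^ k := by
          refine (Finset.card_le_univ _).trans_eq ?_
          rw [Fintype.card_fun]
        rw [hn]
        exact_mod_cast this
  have h1 : E.card * (n ^ k * (a * b ^ 2 * n)) ≤
      k ^ 2 * (ε * n ^ k) * (E.card * n) + n ^ k * (a * b ^ 2 / 2 * (E.card * n)) :=
    hlow.trans (hup.trans (add_le_add (mul_le_mul_of_nonneg_right hbad (by positivity)) le_rfl))
  have h2 : 0 < E.card * n * n ^ k := by positivity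
  nlinarith

end

section
open scoped Classical

theorem exists_biclique_of_card_le {α β : Type*} [Fintype α] [Fintype β] [Nonempty α]
    [Nonempty β]
    {E : Finset (α × β)} {d : ℝ} {h M : ℕ}
    (hE : d * (Fintype.card α * Fintype.card β) ≤ (E.card : ℝ))
    (hα : 2 * h ≤ d * Fintype.card α)
    (hβ : 2 * (2 ^ Fintype.card α * M) ≤ d * Fintype.card β) :
    ∃ (A : Finset α) (B : Finset β), A.card = h ∧ B.card = M ∧ ∀ a ∈ A, ∀ b ∈ B, (a, b) ∈ E := by
  have hαpos : (0 : ℝ) < Fintype.card α := by exact_mod_cast Fintype.card_pos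
  let N : β → Finset α := fun b => Finset.univ.filter fun a => (a, b) ∈ E
  let R : Finset β := Finset.univ.filter fun b => d / 2 * Fintype.card α ≤ ((N b).card : ℝ)
  have hEN : (E.card : ℝ) = ∑ b, ((N b).card : ℝ) := by
    have : E.card = ∑ b, (N b).card := by
      rw [Finset.card_eq_sum_card_fiberwise (f := Prod.snd) (t := Finset.univ) (by simp)]
      refine Finset.sum_congr rfl fun b _ => ?_
      refine Finset.card_bij' (fun x _ => x.1) (fun a _ => (a, b)) ?_ ?_ ?_ ?_
      · rintro ⟨a, b'⟩ hx
        obtain ⟨hx, rfl⟩ := Finset.mem_filter.1 hx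
        simpa [N] using hx
      · intro a ha
        simpa [N] using ha
      · rintro ⟨a, b'⟩ hx
        obtain ⟨hx, rfl⟩ := Finset.mem_filter.1 hx
        rfl
      · exact fun _ _ => rfl
    exact_mod_cast this
  have hR : d / 2 * Fintype.card β ≤ R.card := by
    have h1 : ∑ b ∈ R, ((N b).card : ℝ) ≤ R.card * Fintype.card α := by
      rw [← nsmul_eq_mul]
      exact Finset.sum_le_card_nsmul _ _ _ fun b _ => by exact_mod_cast Finset.card_le_univ _
    have h2 : ∑ b ∈ Rᶜ, ((N b).card : ℝ) ≤ Fintype.card β * (d / 2 * Fintype.card α) := by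
      have hd : 0 ≤ d * Fintype.card α := le_trans (by positivity) hα
      refine (Finset.sum_le_card_nsmul _ _ (d / 2 * Fintype.card α) fun b hb => ?_).trans ?_
      · simp only [R, Finset.mem_compl, Finset.mem_filter, Finset.mem_univ, true_and,
          not_le] at hb
        exact hb.le
      · rw [nsmul_eq_mul]
        refine mul_le_mul_of_nonneg_right ?_ (by linarith)
        exact_mod_cast Finset.card_le_univ _
    have h3 := Finset.sum_add_sum_compl R fun b => ((N b).card : ℝ)
    have h4 : d / 2 * Fintype.card β * Fintype.card α ≤ R.card * Fintype.card α := by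
      rw [hEN] at hE
      nlinarith
    exact le_of_mul_le_mul_right h4 hαpos
  have hsub : ∀ b, ∃ A : Finset α, b ∈ R → A ⊆ N b ∧ A.card = h := fun b => by
    by_cases hb : b ∈ R
    · have h1 := (Finset.mem_filter.1 hb).2
      have h2 : (h : ℝ) ≤ (N b).card := by linarith
      obtain ⟨A, h3, h4⟩ := Finset.exists_subset_card_eq (s := N b) (n := h) (by exact_mod_cast h2)
      exact ⟨A, fun _ => ⟨h3, h4⟩⟩
    · exact ⟨∅, fun h => absurd h hb⟩
  choose f hf using hsub
  by_cases hM : M = 0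
  · obtain ⟨A, -, hA⟩ : ∃ A ⊆ (Finset.univ : Finset α), A.card = h := by
      refine Finset.exists_subset_card_eq ?_
      have hβpos : (0 : ℝ) < Fintype.card β := by exact_mod_cast Fintype.card_pos
      have hcard : (E.card : ℝ) ≤ Fintype.card α * Fintype.card β := by
        rw [← Nat.cast_mul, ← Fintype.card_prod]
        exact_mod_cast Finset.card_le_univ _
      have hd : d ≤ 1 := by
        by_contra! hd
        have : 0 < (Fintype.card α * Fintype.card β : ℝ) := by positivity
        nlinarith
      have : (h : ℝ) ≤ Fintype.card α := by nlinarith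
      rw [Finset.card_univ]
      exact_mod_cast this
    exact ⟨A, ∅, hA, by simp [hM], by simp⟩
  obtain ⟨A, -, hA⟩ := Finset.exists_le_card_fiber_of_mul_le_card_of_maps_to
    (s := R) (t := Finset.univ) (f := f) (n := M) (by simp) ⟨∅, by simp⟩ (by
      rw [Finset.card_univ, Fintype.card_finset]
      have : ((2 ^ Fintype.card α * M : ℕ) : ℝ) ≤ R.card := by push_cast; linarith
      exact_mod_cast this)
  obtain ⟨B, hB, hBM⟩ := Finset.exists_subset_card_eq hA
  have hBR : ∀ b ∈ B, b ∈ R ∧ f b = A := fun b hb => Finset.mem_filter.1 (hB hb)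
  refine ⟨A, B, ?_, hBM, fun a ha b hb => ?_⟩
  · obtain ⟨b, hb⟩ := Finset.card_pos.1 (by omega : 0 < B.card)
    obtain ⟨h1, rfl⟩ := hBR b hb
    exact (hf b h1).2
  · obtain ⟨h1, rfl⟩ := hBR b hb
    exact (Finset.mem_filter.1 ((hf b h1).1 ha)).2

/-- Representatives that are pairwise unrelated under a relation of small degree. -/
theorem exists_pairwise_unrelated {V J : Type*} [Nonempty V] {r : V → V → Prop}
    (hr : ∀ x y, r x y → r y x)
    {S : Finset V} {x : ℝ} (hx : 0 < x) (hS : ∀ z, ((S.filter (r z)).card : ℝ) < x)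
    (Z : J → Finset V) (k : ℕ) : ∀ I : Finset J, I.card ≤ k →
    (∀ i ∈ I, Z i ⊆ S) → (∀ i ∈ I, k * x ≤ ((Z i).card : ℝ)) →
      ∃ z : J → V, (∀ i ∈ I, z i ∈ Z i) ∧ ∀ i ∈ I, ∀ j ∈ I, i ≠ j → ¬ r (z i) (z j) := by
  intro I
  induction I using Finset.induction_on with
  | empty => exact fun _ _ _ => ⟨fun _ => Classical.arbitrary V, by simp⟩
  | insert j I hj ih =>
    intro hk hZS hZ
    rw [Finset.card_insert_of_notMem hj] at hk
    obtain ⟨z, hz1, hz2⟩ := ih (by omega) (fun i hi => hZS i (Finset.mem_insert_of_mem hi))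
      (fun i hi => hZ i (Finset.mem_insert_of_mem hi))
    obtain ⟨y, hy, hyI⟩ : ∃ y ∈ Z j, y ∉ I.biUnion fun i => S.filter (r (z i)) := by
      by_contra! hcon
      have h1 : ((Z j).card : ℝ) ≤ ∑ i ∈ I, ((S.filter (r (z i))).card : ℝ) := by
        exact_mod_cast (Finset.card_le_card hcon).trans Finset.card_biUnion_le
      have h2 : ∑ i ∈ I, ((S.filter (r (z i))).card : ℝ) ≤ I.card * x := by
        rw [← nsmul_eq_mul]
        exact Finset.sum_le_card_nsmul _ _ _ fun i _ => (hS (z i)).le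
      have h3 := hZ j (Finset.mem_insert_self j I)
      have h4 : ((I.card : ℝ) + 1) ≤ k := by exact_mod_cast hk
      nlinarith
    have hyr : ∀ i ∈ I, ¬ r (z i) y := fun i hi h => hyI (Finset.mem_biUnion.2
      ⟨i, hi, Finset.mem_filter.2 ⟨hZS j (Finset.mem_insert_self j I) hy, h⟩⟩)
    have hne : ∀ i ∈ I, i ≠ j := fun i hi h => hj (h ▸ hi)
    refine ⟨Function.update z j y, fun i hi => ?_, fun i hi i' hi' hii' => ?_⟩
    · rcases Finset.mem_insert.1 hi with rfl | hi
      · simpa using hy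
      · rw [Function.update_of_ne (hne i hi)]
        exact hz1 i hi
    · rcases Finset.mem_insert.1 hi with h | h <;> rcases Finset.mem_insert.1 hi' with h' | h'
      · exact absurd (h.trans h'.symm) hii'
      · subst h
        rw [Function.update_self, Function.update_of_ne (hne i' h')]
        exact fun h => hyr i' h' (hr _ _ h)
      · subst h'
        rw [Function.update_self, Function.update_of_ne (hne i h)]
        exact hyr i h
      · rw [Function.update_of_ne (hne i h), Function.update_of_ne (hne i' h')]
        exact hz2 i h i' h' hii'

/-- If every vertex of some large set is joined inside it to few others only, there is a
template. -/
theorem IsCoherent.nonempty_template_of_forall_card_lt {V : Type*} [Fintype V] [Nonempty V]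
    {G : SimpleGraph V} {ε κ η : ℝ} (hG : IsCoherent G ε) {U : Type*} [Fintype U]
    (H : SimpleGraph U) (hη : 0 < η) (hη1 : 2 * η ≤ 1)
    {S : Finset V} (hS : κ * Fintype.card V ≤ S.card)
    (hrel : ∀ z, ((S.filter (SmallJoined G (η * Fintype.card V) S z)).card : ℝ) <
      ε * Fintype.card V) {a b : ℕ} (ha : 0 < a) (hb : 0 < b) {δ : ℝ}
    (hδ : δ = κ / 2 * (η / 8) ^ 2 / 2)
    (haU : 2 * Fintype.card U ≤ δ / 2 * a) (hbM : 2 * (2 ^ a * H.edgeFinset.card) ≤ δ / 2 * b)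
    (hε1 : (a + b : ℝ) ^ 2 * ε < δ) (hε2 : 2 * ((a + b + 1) * ε) ≤ κ) (hε3 : 6 * ε ≤ κ)
    (hε4 : 8 * ε ≤ η) (hε5 : Fintype.card U * H.edgeFinset.card * ε ≤ δ / 2) :
    Nonempty (SubdivisionTemplate G H) := by
  have hN := hG.one_le
  have hV : (0 : ℝ) < Fintype.card V := by exact_mod_cast Fintype.card_pos
  have hε : 0 < ε := by
    by_contra! h
    nlinarith
  set n : ℝ := (Fintype.card V : ℝ) with hn
  set m : ℝ := η * n with hm
  have hgiant : ∀ D : Finset V, ∃ C : Finset V, (D.card : ℝ) + ε * n ≤ κ / 2 * n →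
      C ⊆ S \ D ∧ CutConnected G C ∧ κ / 2 * n ≤ C.card := by
    intro D
    by_cases hD : (D.card : ℝ) + ε * n ≤ κ / 2 * n
    · have h1 : (S.card : ℝ) ≤ (S \ D).card + D.card := by
        have := Finset.le_card_sdiff D S
        have h2 : S.card ≤ (S \ D).card + D.card := by omega
        exact_mod_cast h2
      obtain ⟨C, hC1, hC2, hC3⟩ := hG.exists_cutConnected (X := S \ D) (by
        rw [← hn]
        nlinarith)
      have h2 : (((S \ D) \ C).card : ℝ) + C.card = (S \ D).card := by
        exact_mod_cast Finset.card_sdiff_add_card_eq_card hC1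
      refine ⟨C, fun _ => ⟨hC1, hC2, ?_⟩⟩
      rw [← hn] at hC3
      linarith
    · exact ⟨∅, fun h => absurd h hD⟩
  choose C hC using hgiant
  have hprobe : ∀ (D : Finset V) (z : V), ∃ P : Finset V, (D.card : ℝ) + ε * n ≤ κ / 2 * n →
      z ∈ C D → P ⊆ C D ∧ CutConnected G P ∧ z ∈ P ∧ ((closedNbhd G P).card : ℝ) ≤ m / 2 ∧
      m / 8 ≤ ((closedNbhd G P \ P).card : ℝ) := by
    intro D z
    by_cases hD : (D.card : ℝ) + ε * n ≤ κ / 2 * n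
    · by_cases hz : z ∈ C D
      · obtain ⟨h1, h2, h3⟩ := hC D hD
        obtain ⟨P, hP⟩ := hG.exists_probe (m := m) h2 (by rw [← hn]; nlinarith)
          (by rw [← hn, hm]; nlinarith) (by rw [← hn, hm]; nlinarith) hz
        exact ⟨P, fun _ _ => hP⟩
      · exact ⟨∅, fun _ h => absurd h hz⟩
    · exact ⟨∅, fun h => absurd h hD⟩
  choose P hP using hprobe
  let A : Finset V → V → Finset V := fun D z => closedNbhd G (P D z) \ P D z
  have hsmall : ∀ (p q : Fin a ⊕ Fin b) (ω : Fin a ⊕ Fin b → V),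
      ((nbhdExcept G p q ω).card : ℝ) + ε * n ≤ κ / 2 * n := by
    intro p q ω
    have h1 := hG.card_nbhdExcept_le hε.le p q ω
    simp only [Fintype.card_sum, Fintype.card_fin, Nat.cast_add] at h1
    nlinarith
  let E : Finset ((Fin a ⊕ Fin b) × (Fin a ⊕ Fin b)) := (Finset.univ : Finset (Fin a × Fin b)).map
    ⟨fun x => (Sum.inl x.1, Sum.inr x.2), fun x y h => by
      simp only [Prod.mk.injEq, Sum.inl.injEq, Sum.inr.injEq] at h
      exact Prod.ext h.1 h.2⟩
  have : Nonempty (Fin a) := ⟨⟨0, ha⟩⟩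
  have : Nonempty (Fin b) := ⟨⟨0, hb⟩⟩
  obtain ⟨ω, hω, hωX⟩ := hG.exists_selection (ι := Fin a ⊕ Fin b) (C := C) (A := A)
    (a := κ / 2) (b := η / 8) (by linarith) (E := E)
    (by
      intro e he
      obtain ⟨x, -, rfl⟩ := Finset.mem_map.1 he
      simp)
    (by simp [E])
    (fun p q ω => (hC _ (hsmall p q ω)).2.2)
    (fun p q ω z hz => by
      refine le_trans (le_of_eq ?_) (hP _ z (hsmall p q ω) hz).2.2.2.2
      rw [hm, ← hn]; ring)
    (by
      simp only [Fintype.card_sum, Fintype.card_fin, Nat.cast_add]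
      linarith)
  simp only [E, Finset.sum_map, Finset.card_map] at hωX
  let X : Fin a × Fin b → Finset V := fun x => doubleHits G C A (Sum.inl x.1) (Sum.inr x.2) ω
  let good : Finset (Fin a × Fin b) := Finset.univ.filter fun x => δ / 2 * n ≤ ((X x).card : ℝ)
  have hδpos : 0 < δ := lt_of_le_of_lt (by positivity) hε1
  have hgood : δ / 2 * (Fintype.card (Fin a) * Fintype.card (Fin b)) ≤ (good.card : ℝ) := by
    have h1 : ∑ x ∈ good, ((X x).card : ℝ) ≤ good.card * n := by
      rw [← nsmul_eq_mul]
      exact Finset.sum_le_card_nsmul _ _ _ fun x _ => by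
        rw [hn]; exact_mod_cast Finset.card_le_univ _
    have h2 : ∑ x ∈ goodᶜ, ((X x).card : ℝ) ≤ (a * b : ℝ) * (δ / 2 * n) := by
      refine (Finset.sum_le_card_nsmul _ _ (δ / 2 * n) fun x hx => ?_).trans ?_
      · simp only [good, Finset.mem_compl, Finset.mem_filter, Finset.mem_univ, true_and,
          not_le] at hx
        exact hx.le
      · rw [nsmul_eq_mul]
        refine mul_le_mul_of_nonneg_right ?_ (by positivity)
        have : goodᶜ.card ≤ a * b := by
          refine (Finset.card_le_univ _).trans_eq ?_
          simp
        exact_mod_cast this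
    have h3 := Finset.sum_add_sum_compl good fun x => ((X x).card : ℝ)
    replace hωX : κ / 2 * (η / 8) ^ 2 / 2 * ((Finset.univ : Finset (Fin a × Fin b)).card * n) ≤
        ∑ x, ((X x).card : ℝ) := hωX
    rw [← hδ, ← h3, Finset.card_univ, Fintype.card_prod, Fintype.card_fin, Fintype.card_fin,
      Nat.cast_mul] at hωX
    rw [Fintype.card_fin, Fintype.card_fin]
    refine le_of_mul_le_mul_right ?_ hV
    nlinarith
  obtain ⟨Q, R, hQ, hR, hQR⟩ := exists_biclique_of_card_le (h := Fintype.card U)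
    (M := H.edgeFinset.card) hgood (by simpa using haU) (by simpa using hbM)
  obtain ⟨φ⟩ : Nonempty (U ≃ Q) := by
    rw [← Fintype.card_eq]; simp [hQ]
  obtain ⟨ψ⟩ : Nonempty (H.edgeFinset ≃ R) := by
    rw [← Fintype.card_eq, Fintype.card_coe, Fintype.card_coe, hR]
  have hq : ∀ e : Sym2 U, ∃ y : Fin b, ∀ he : e ∈ H.edgeFinset, y = ψ ⟨e, he⟩ := fun e => by
    by_cases he : e ∈ H.edgeFinset
    · exact ⟨ψ ⟨e, he⟩, fun _ => rfl⟩
    · exact ⟨Classical.arbitrary _, fun h => absurd h he⟩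
  choose q hq using hq
  have hqinj : ∀ e ∈ H.edgeFinset, ∀ f ∈ H.edgeFinset, e ≠ f → q e ≠ q f := by
    intro e he f hf hne heq
    rw [hq e he, hq f hf] at heq
    exact hne (congrArg Subtype.val (ψ.injective (Subtype.ext heq)))
  have hφinj : ∀ u w, u ≠ w → (φ u : Fin a) ≠ φ w := fun u w huw h =>
    huw (φ.injective (Subtype.ext h))
  let D : U × Sym2 U → Finset V := fun x =>
    nbhdExcept G (Sum.inl (φ x.1 : Fin a)) (Sum.inr (q x.2)) ω
  have hDs : ∀ x, ((D x).card : ℝ) + ε * n ≤ κ / 2 * n := fun x => hsmall _ _ ω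
  have hXgood : ∀ u, ∀ e ∈ H.edgeFinset, δ / 2 * n ≤ ((X (φ u, q e)).card : ℝ) := by
    intro u e he
    have := hQR _ (φ u).2 (q e) (by rw [hq e he]; exact (ψ _).2)
    exact (Finset.mem_filter.1 this).2
  have hXC : ∀ x : U × Sym2 U, X (φ x.1, q x.2) ⊆ C (D x) := fun x => Finset.filter_subset _ _
  obtain ⟨z, hzX, hzrel⟩ := exists_pairwise_unrelated (J := U × Sym2 U)
    (r := SmallJoined G m S) (fun _ _ => SmallJoined.symm) (by linarith : 0 < ε * n) hrel
    (fun x => X (φ x.1, q x.2)) (Fintype.card U * H.edgeFinset.card)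
    (Finset.univ ×ˢ H.edgeFinset) (by rw [Finset.card_product, Finset.card_univ])
    (fun x _ => (hXC x).trans ((hC _ (hDs x)).1.trans Finset.sdiff_subset))
    (fun x hx => by
      refine le_trans ?_ (hXgood x.1 x.2 (Finset.mem_product.1 hx).2)
      push_cast
      nlinarith)
  have hmemI : ∀ u, ∀ e ∈ H.edgeFinset, (u, e) ∈ (Finset.univ : Finset U) ×ˢ H.edgeFinset :=
    fun u e he => by simpa using he
  let B : U → Sym2 U → Finset V := fun u e => P (D (u, e)) (z (u, e))
  have hB : ∀ u, ∀ e ∈ H.edgeFinset, B u e ⊆ S \ D (u, e) ∧ CutConnected G (B u e) ∧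
      z (u, e) ∈ B u e ∧ ((closedNbhd G (B u e)).card : ℝ) ≤ m / 2 := by
    intro u e he
    have h1 := hXC (u, e) (hzX _ (hmemI u e he))
    obtain ⟨h2, h3, h4, h5, -⟩ := hP _ _ (hDs (u, e)) h1
    exact ⟨h2.trans (hC _ (hDs (u, e))).1, h3, h4, h5⟩
  have hhit : ∀ u, ∀ e ∈ H.edgeFinset, ω (Sum.inl (φ u)) ∈ closedNbhd G (B u e) \ B u e ∧
      ω (Sum.inr (q e)) ∈ closedNbhd G (B u e) \ B u e := by
    intro u e he
    exact (Finset.mem_filter.1 (hzX _ (hmemI u e he))).2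
  have hadj : ∀ u, ∀ e ∈ H.edgeFinset, ∀ x ∈ closedNbhd G (B u e) \ B u e,
      ∃ y ∈ B u e, G.Adj x y := by
    intro u e he x hx
    rw [Finset.mem_sdiff, mem_closedNbhd] at hx
    obtain ⟨h1 | ⟨y, hy, hyx⟩, h2⟩ := hx
    · exact absurd h1 h2
    · exact ⟨y, hy, hyx.symm⟩
  have hfar : ∀ u, ∀ e ∈ H.edgeFinset, ∀ k, k ≠ Sum.inl (φ u : Fin a) → k ≠ Sum.inr (q e) →
      ∀ y ∈ B u e, ω k ≠ y ∧ ¬ G.Adj (ω k) y := by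
    intro u e he k h1 h2 y hy
    have h3 : y ∉ D (u, e) := (Finset.mem_sdiff.1 ((hB u e he).1 hy)).2
    have h4 : y ∉ closedNbhd G {ω k} := fun h => h3 (mem_nbhdExcept h1 h2 h)
    rw [mem_closedNbhd_singleton] at h4
    push Not at h4
    exact ⟨h4.1.symm, h4.2⟩
  have hωω : ∀ k l, k ≠ l → ω k ≠ ω l ∧ ¬ G.Adj (ω k) (ω l) := by
    intro k l hkl
    have h4 := hω l k hkl.symm
    rw [mem_closedNbhd_singleton] at h4
    push Not at h4
    exact ⟨h4.1.symm, h4.2⟩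
  have hlink : ∀ e, ∀ y ∈ (Finset.univ.filter (· ∈ e)).biUnion
      (fun u => insert (ω (Sum.inr (q e))) (B u e)),
      y = ω (Sum.inr (q e)) ∨ ∃ u ∈ e, y ∈ B u e := by
    intro e y hy
    obtain ⟨u, hu, hy⟩ := Finset.mem_biUnion.1 hy
    rcases Finset.mem_insert.1 hy with h | h
    · exact Or.inl h
    · exact Or.inr ⟨u, by simpa using hu, h⟩
  refine ⟨⟨fun u => ω (Sum.inl (φ u)), fun u w h => ?_, fun u w huw => ?_,
    fun e => (Finset.univ.filter (· ∈ e)).biUnion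
      (fun u => insert (ω (Sum.inr (q e))) (B u e)),
    fun e he => ?_, fun e he u hu => ?_, fun e he u hu => ?_, fun e he u hu y hy => ?_,
    fun e he f hf hef x hx y hy => ?_⟩⟩
  · by_contra huw
    exact (hωω _ _ fun h' => hφinj u w huw (Sum.inl_injective h')).1 h
  · by_cases h : u = w
    · subst h
      exact G.loopless.irrefl _ huw
    · exact (hωω _ _ fun h' => hφinj u w h (Sum.inl_injective h')).2 huw
  · rw [← SimpleGraph.mem_edgeFinset] at he
    refine CutConnected.biUnion (z := ω (Sum.inr (q e))) ?_ (fun u _ => ?_) (fun u _ => by simp)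
    · induction e with
      | _ x y => exact ⟨x, by simp⟩
    · obtain ⟨y, hy, hadj'⟩ := hadj u e he _ (hhit u e he).2
      exact (hB u e he).2.1.insert hy hadj'
  · rw [← SimpleGraph.mem_edgeFinset] at he
    obtain ⟨y, hy, hadj'⟩ := hadj u e he _ (hhit u e he).1
    exact ⟨y, Finset.mem_biUnion.2 ⟨u, by simpa using hu, Finset.mem_insert_of_mem hy⟩, hadj'⟩
  · rw [← SimpleGraph.mem_edgeFinset] at he
    rcases hlink e _ hu with h | ⟨w, hw, h⟩
    · exact (hωω _ _ (by simp)).1 h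
    · by_cases huw : u = w
      · subst huw
        exact (Finset.mem_sdiff.1 (hhit u e he).1).2 h
      · exact (hfar w e he _ (fun h' => hφinj u w huw (Sum.inl_injective h')) (by simp) _ h).1 rfl
  · rw [← SimpleGraph.mem_edgeFinset] at he
    rcases hlink e _ hy with rfl | ⟨w, hw, h⟩
    · exact (hωω _ _ (by simp)).2
    · have huw : u ≠ w := fun h => hu (h ▸ hw)
      exact (hfar w e he _ (fun h' => hφinj u w huw (Sum.inl_injective h')) (by simp) _ h).2
  · rw [← SimpleGraph.mem_edgeFinset] at he hf
    have hqef := hqinj e he f hf hef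
    rcases hlink e _ hx with rfl | ⟨u, hu, hxB⟩ <;> rcases hlink f _ hy with rfl | ⟨w, hw, hyB⟩
    · exact hωω _ _ fun h => hqef (Sum.inr_injective h)
    · exact hfar w f hf _ (by simp) (fun h => hqef (Sum.inr_injective h)) _ hyB
    · have := hfar u e he (Sum.inr (q f)) (by simp)
        (fun h => hqef (Sum.inr_injective h).symm) _ hxB
      exact ⟨this.1.symm, fun h => this.2 h.symm⟩
    · have h1 := hB u e he
      have h2 := hB w f hf
      exact anticomplete_of_not_smallJoined
        (hzrel _ (hmemI u e he) _ (hmemI w f hf) fun h => hef (congrArg Prod.snd h))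
        (h1.1.trans Finset.sdiff_subset) (h2.1.trans Finset.sdiff_subset) h1.2.1 h2.2.1
        h1.2.2.1 h2.2.2.1 h1.2.2.2 h2.2.2.2 x hxB y hyB

end

section
open scoped Classical

theorem eventually_mul_lt_nhdsGT_zero (c : ℝ) {d : ℝ} (hd : 0 < d) :
    ∀ᶠ ε in nhdsWithin (0 : ℝ) (Set.Ioi 0), c * ε < d := by
  have h : Filter.Tendsto (fun ε : ℝ => c * ε) (nhdsWithin 0 (Set.Ioi 0)) (nhds (c * 0)) :=
    ((continuous_const.mul continuous_id).tendsto 0).mono_left nhdsWithin_le_nhds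
  rw [mul_zero] at h
  exact h.eventually (gt_mem_nhds hd)

/-- Sufficiently coherent graphs contain a template of any given graph. -/
theorem exists_coherent_nonempty_template.{u, v} {U : Type u} [Fintype U] (H : SimpleGraph U) :
    ∃ ε : ℝ, 0 < ε ∧ ∀ (V : Type v) [Fintype V] [Nonempty V] (G : SimpleGraph V),
      IsCoherent G ε → Nonempty (SubdivisionTemplate G H) := by
  set h := Fintype.card U with hh
  set M := H.edgeFinset.card with hM
  obtain ⟨κ, hκ, hκ1, hκK⟩ : ∃ κ : ℝ, 0 < κ ∧ κ ≤ 1 ∧ 2 * 2 ^ M * 4 ^ (2 ^ M) * κ ≤ 1 := by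
    have h1 : (1 : ℝ) ≤ 2 * 2 ^ M * 4 ^ (2 ^ M) := by
      have h2 : (1 : ℝ) ≤ 2 ^ M := one_le_pow₀ (by norm_num)
      have h3 : (1 : ℝ) ≤ 4 ^ (2 ^ M) := one_le_pow₀ (by norm_num)
      nlinarith
    refine ⟨(2 * 2 ^ M * 4 ^ (2 ^ M))⁻¹, by positivity, inv_le_one_of_one_le₀ h1, ?_⟩
    exact (mul_inv_cancel₀ (by positivity)).le
  obtain ⟨η, hη, hη1, hη2⟩ : ∃ η : ℝ, 0 < η ∧ 4 * η ≤ κ ∧ h * (2 * (M * η)) ≤ κ / 2 := by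
    have h1 : (0 : ℝ) ≤ h := Nat.cast_nonneg _
    have h2 : (0 : ℝ) ≤ M := Nat.cast_nonneg _
    have h3 : κ / (4 * (h + 1) * (M + 1)) * (4 * (h + 1) * (M + 1)) = κ :=
      div_mul_cancel₀ _ (by positivity)
    refine ⟨κ / (4 * (h + 1) * (M + 1)), by positivity, ?_, ?_⟩
    all_goals
      have h4 : 0 < κ / (4 * (h + 1) * (M + 1)) := by positivity
      set η := κ / (4 * (h + 1) * (M + 1))
      have h5 : 0 ≤ η * h := by positivity
      have h6 : 0 ≤ η * M := by positivity
      have h7 : 0 ≤ η * (h * M) := by positivity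
      nlinarith
  obtain ⟨δ, hδ⟩ : ∃ δ : ℝ, δ = κ / 2 * (η / 8) ^ 2 / 2 := ⟨_, rfl⟩
  have hδpos : 0 < δ := by rw [hδ]; positivity
  obtain ⟨a, ha, haU⟩ : ∃ a : ℕ, 0 < a ∧ 2 * (h : ℝ) ≤ δ / 2 * a := by
    obtain ⟨a, ha⟩ := exists_nat_ge (2 * (h : ℝ) / (δ / 2))
    refine ⟨a + 1, by omega, ?_⟩
    rw [div_le_iff₀ (by positivity)] at ha
    push_cast
    nlinarith
  obtain ⟨b, hb, hbM⟩ : ∃ b : ℕ, 0 < b ∧ 2 * (2 ^ a * (M : ℝ)) ≤ δ / 2 * b := by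
    obtain ⟨b, hb⟩ := exists_nat_ge (2 * (2 ^ a * (M : ℝ)) / (δ / 2))
    refine ⟨b + 1, by omega, ?_⟩
    rw [div_le_iff₀ (by positivity)] at hb
    push_cast
    nlinarith
  obtain ⟨ε, ⟨⟨⟨⟨⟨h1, h2⟩, h3⟩, h4⟩, h5⟩, h6⟩, hε⟩ :=
    (((((((eventually_mul_lt_nhdsGT_zero ((a + b : ℝ) ^ 2) hδpos).and
      (eventually_mul_lt_nhdsGT_zero (2 * (a + b + 1)) hκ)).and
      (eventually_mul_lt_nhdsGT_zero 6 hκ)).and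
      (eventually_mul_lt_nhdsGT_zero 8 hη)).and
      (eventually_mul_lt_nhdsGT_zero (h * M) (half_pos hδpos))).and
      (eventually_mul_lt_nhdsGT_zero (h * 3) (half_pos hκ))).and self_mem_nhdsWithin).exists
  refine ⟨ε, hε, fun V _ _ G hG => ?_⟩
  have hN := hG.one_le
  have hV : (0 : ℝ) < Fintype.card V := by exact_mod_cast Fintype.card_pos
  by_cases hT : ∀ S : Finset V, κ * Fintype.card V ≤ S.card → ∃ z, ε * Fintype.card V ≤
      ((S.filter (SmallJoined G (η * Fintype.card V) S z)).card : ℝ)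
  · obtain ⟨T, Θ, hT1, hΘ, hbr, hanti⟩ := hG.exists_brooms M (by linarith)
      (mul_le_mul_of_nonneg_right (by linarith) hV.le) hκK hT
    refine hG.nonempty_template_of_brooms H hΘ hbr hanti ?_ ?_
    · rw [← Finset.card_pos]
      have : (0 : ℝ) < T.card := lt_of_lt_of_le (by positivity) hT1
      exact_mod_cast this
    · refine le_trans ?_ hT1
      rw [← hh, ← hM]
      have hh0 : (0 : ℝ) ≤ h := Nat.cast_nonneg _
      calc (h : ℝ) * (2 * (M * (η * Fintype.card V) + ε * Fintype.card V) + 1)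
          ≤ h * (2 * (M * (η * Fintype.card V) + ε * Fintype.card V) + ε * Fintype.card V) :=
            mul_le_mul_of_nonneg_left (by linarith) hh0
        _ = (h * (2 * (M * η)) + h * 3 * ε) * Fintype.card V := by ring
        _ ≤ κ * Fintype.card V := mul_le_mul_of_nonneg_right (by linarith) hV.le
  · push Not at hT
    obtain ⟨S, hS, hrel⟩ := hT
    exact hG.nonempty_template_of_forall_card_lt H hη (by linarith) hS hrel ha hb hδ haU hbM h1
      (by linarith) h3.le h4.le h5.le

end

section
open scoped Classical

/-- Either equal-sized disjoint sets have a transversal inducing a copy of a given pattern, or there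
are two of their subsets with few edges or few non-edges between them. -/
theorem exists_transversal_or_sparse_pair {V ι : Type*} [Nonempty V] (G : SimpleGraph V)
    (F : SimpleGraph ι)
    {ρ : ℝ} (hρ : 0 < ρ) (hρ1 : ρ ≤ 1) {r : ℕ} (Y : Finset V) : ∀ (I : Finset ι) (s : ℕ)
    (C : ι → Finset V), I.card ≤ r → 1 ≤ s → (∀ i ∈ I, C i ⊆ Y ∧ (C i).card = s) →
    (∀ i ∈ I, ∀ j ∈ I, i ≠ j → Disjoint (C i) (C j)) →
    (∃ v : ι → V, (∀ i ∈ I, v i ∈ C i) ∧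
      ∀ i ∈ I, ∀ j ∈ I, i ≠ j → (G.Adj (v i) (v j) ↔ F.Adj i j)) ∨
    ∃ A ⊆ Y, ∃ B ⊆ Y, Disjoint A B ∧ ρ ^ I.card * s ≤ (B.card : ℝ) ∧
      B.card ≤ r * A.card ∧ ∃ J : SimpleGraph V, (J = G ∨ J = Gᶜ) ∧
        ∀ a ∈ A, ((B.filter (J.Adj a)).card : ℝ) ≤ ρ * B.card := by
  intro I
  induction I using Finset.induction_on with
  | empty => exact fun s C _ _ _ _ => Or.inl ⟨Classical.arbitrary _, by simp⟩
  | insert i₀ I hi₀ ih =>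
    intro s C hr hs hC hdisj
    rw [Finset.card_insert_of_notMem hi₀] at hr ⊢
    have hne : ∀ i ∈ I, i₀ ≠ i := fun i hi h => hi₀ (h ▸ hi)
    have hins : ∀ i ∈ I, i ∈ insert i₀ I := fun i hi => Finset.mem_insert_of_mem hi
    have hs0 : (1 : ℝ) ≤ s := by exact_mod_cast hs
    let N : V → ι → Finset V := fun a i => (C i).filter fun b => G.Adj a b ↔ F.Adj i₀ i
    by_cases hgood : ∃ a ∈ C i₀, ∀ i ∈ I, ρ * s ≤ ((N a i).card : ℝ)
    · obtain ⟨a, ha, hN⟩ := hgood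
      have hex : ∀ i, ∃ D : Finset V, i ∈ I → D ⊆ N a i ∧ D.card = ⌈ρ * s⌉₊ := fun i => by
        by_cases hi : i ∈ I
        · obtain ⟨D, h1, h2⟩ := Finset.exists_subset_card_eq (Nat.ceil_le.2 (hN i hi))
          exact ⟨D, fun _ => ⟨h1, h2⟩⟩
        · exact ⟨∅, fun h => absurd h hi⟩
      choose D hD using hex
      have hDC : ∀ i ∈ I, D i ⊆ C i := fun i hi => (hD i hi).1.trans (Finset.filter_subset _ _)
      rcases ih ⌈ρ * s⌉₊ D (by omega) (Nat.ceil_pos.2 (by positivity))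
        (fun i hi => ⟨(hDC i hi).trans (hC i (hins i hi)).1, (hD i hi).2⟩)
        (fun i hi j hj hij => (hdisj i (hins i hi) j (hins j hj) hij).mono (hDC i hi) (hDC j hj))
        with ⟨v, hv1, hv2⟩ | ⟨A, hA, B, hB, hAB, hB1, hB2⟩
      · left
        have hav : ∀ i ∈ I, G.Adj a (v i) ↔ F.Adj i₀ i := fun i hi =>
          (Finset.mem_filter.1 ((hD i hi).1 (hv1 i hi))).2
        refine ⟨Function.update v i₀ a, fun i hi => ?_, fun i hi j hj hij => ?_⟩
        · rcases Finset.mem_insert.1 hi with rfl | hi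
          · simpa using ha
          · rw [Function.update_of_ne (hne i hi).symm]
            exact hDC i hi (hv1 i hi)
        · rcases Finset.mem_insert.1 hi with h | h <;> rcases Finset.mem_insert.1 hj with h' | h'
          · exact absurd (h.trans h'.symm) hij
          · subst h
            rw [Function.update_self, Function.update_of_ne (hne j h').symm]
            exact hav j h'
          · subst h'
            rw [Function.update_self, Function.update_of_ne (hne i h).symm, G.adj_comm, F.adj_comm]
            exact hav i h
          · rw [Function.update_of_ne (hne i h).symm, Function.update_of_ne (hne j h').symm]
            exact hv2 i h j h' hij
      · refine Or.inr ⟨A, hA, B, hB, hAB, le_trans ?_ hB1, hB2⟩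
        rw [pow_succ, mul_assoc]
        exact mul_le_mul_of_nonneg_left (Nat.le_ceil _) (by positivity)
    · right
      push Not at hgood
      have hex : ∀ a, ∃ i, a ∈ C i₀ → i ∈ I ∧ ((N a i).card : ℝ) < ρ * s := fun a => by
        by_cases ha : a ∈ C i₀
        · obtain ⟨i, hi⟩ := hgood a ha
          exact ⟨i, fun _ => hi⟩
        · exact ⟨i₀, fun h => absurd h ha⟩
      choose f hf using hex
      have hC0 := hC i₀ (Finset.mem_insert_self _ _)
      have hI : I.Nonempty := by
        obtain ⟨a, ha⟩ := Finset.card_pos.1 (by omega : 0 < (C i₀).card)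
        exact ⟨f a, (hf a ha).1⟩
      obtain ⟨i, hi, hcard⟩ : ∃ i ∈ I, s ≤ r * ((C i₀).filter fun a => f a = i).card := by
        by_contra! hcon
        have h1 := Finset.card_eq_sum_card_fiberwise (f := f) (s := C i₀) (t := I)
          fun a ha => (hf a ha).1
        have h2 : ∑ i ∈ I, r * ((C i₀).filter fun a => f a = i).card < ∑ i ∈ I, s :=
          Finset.sum_lt_sum_of_nonempty hI hcon
        rw [← Finset.mul_sum, ← h1, hC0.2, Finset.sum_const, smul_eq_mul] at h2
        have := Nat.lt_of_mul_lt_mul_right h2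
        omega
      refine ⟨(C i₀).filter fun a => f a = i, (Finset.filter_subset _ _).trans hC0.1, C i,
        (hC i (hins i hi)).1,
        (hdisj i₀ (Finset.mem_insert_self _ _) i (hins i hi) (hne i hi)).mono_left
          (Finset.filter_subset _ _), ?_, ?_, if F.Adj i₀ i then G else Gᶜ, ?_, ?_⟩
      · rw [(hC i (hins i hi)).2]
        exact mul_le_of_le_one_left (by linarith) (pow_le_one₀ hρ.le hρ1)
      · rw [(hC i (hins i hi)).2]
        exact hcard
      · split_ifs <;> simp
      · intro a ha
        obtain ⟨ha', rfl⟩ := Finset.mem_filter.1 ha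
        rw [(hC _ (hins _ hi)).2]
        refine le_trans ?_ (hf a ha').2.le
        have hsub : (C (f a)).filter ((if F.Adj i₀ (f a) then G else Gᶜ).Adj a) ⊆ N a (f a) := by
          intro b hb
          obtain ⟨hb, hab⟩ := Finset.mem_filter.1 hb
          refine Finset.mem_filter.2 ⟨hb, ?_⟩
          split_ifs at hab with h
          · simp [h, hab]
          · rw [SimpleGraph.compl_adj] at hab
            simp [h, hab.2]
        exact_mod_cast Finset.card_le_card hsub

/-- A graph without induced copies of a given pattern has, in every large set, two large subsets
with few edges or few non-edges between them. -/
theorem exists_sparse_pair {V ι : Type*} [Fintype ι] {G : SimpleGraph V} {F : SimpleGraph ι}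
    (hF : IsEmpty (F ↪g G)) {ρ : ℝ} (hρ : 0 < ρ) (hρ1 : ρ ≤ 1) {Y : Finset V}
    (hY : Fintype.card ι + 1 ≤ Y.card) :
    ∃ A ⊆ Y, ∃ B ⊆ Y, Disjoint A B ∧
      ρ ^ Fintype.card ι / (2 * (Fintype.card ι + 1)) * Y.card ≤ (B.card : ℝ) ∧
      B.card ≤ (Fintype.card ι + 1) * A.card ∧ ∃ J : SimpleGraph V, (J = G ∨ J = Gᶜ) ∧
        ∀ a ∈ A, ((B.filter (J.Adj a)).card : ℝ) ≤ ρ * B.card := by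
  set r := Fintype.card ι + 1 with hr
  have : Nonempty V := by
    obtain ⟨y, -⟩ := Finset.card_pos.1 (by omega : 0 < Y.card)
    exact ⟨y⟩
  have hs : 1 ≤ Y.card / r := (Nat.one_le_div_iff (by omega)).2 hY
  obtain ⟨B, hB1, hB2⟩ := Finset.exists_disjoint_blocks (Y.card / r) r Y (Nat.mul_div_le _ _)
  have hlt : ∀ i, (Fintype.equivFin ι i : ℕ) < r := fun i => by
    have := (Fintype.equivFin ι i).2
    omega
  rcases exists_transversal_or_sparse_pair G F hρ hρ1 (r := r) Y Finset.univ (Y.card / r)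
    (fun i => B (Fintype.equivFin ι i)) (by rw [Finset.card_univ]; omega) hs
    (fun i _ => hB1 _ (hlt i))
    (fun i _ j _ hij => hB2 _ (hlt i) _ (hlt j) fun h =>
      hij ((Fintype.equivFin ι).injective (Fin.ext h)))
    with ⟨v, hv1, hv2⟩ | ⟨A, hA, B, hB, hAB, hB1, hB2⟩
  · have hinj : Function.Injective v := fun i j hij => by
      by_contra hne
      have hd := hB2 _ (hlt i) _ (hlt j) fun h =>
        hne ((Fintype.equivFin ι).injective (Fin.ext h))
      exact Finset.disjoint_left.1 hd (hv1 i (Finset.mem_univ _))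
        (hij ▸ hv1 j (Finset.mem_univ _))
    refine (hF.false ⟨⟨v, hinj⟩, ?_⟩).elim
    intro i j
    rcases eq_or_ne i j with rfl | hij
    · simp
    · exact hv2 i (Finset.mem_univ _) j (Finset.mem_univ _) hij
  · refine ⟨A, hA, B, hB, hAB, le_trans ?_ hB1, hB2⟩
    rw [Finset.card_univ, div_mul_eq_mul_div, mul_div_assoc]
    refine mul_le_mul_of_nonneg_left ?_ (by positivity)
    rw [div_le_iff₀ (by positivity)]
    have h1 : Y.card < (Y.card / r + 1) * r := by
      rw [mul_comm]; exact Nat.lt_mul_div_succ _ (by omega)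
    have h2 : Y.card ≤ Y.card / r * (2 * r) := by nlinarith
    rw [hr] at h2 ⊢
    exact_mod_cast h2

/-- A sequence of large disjoint sets such that the edges between any two are sparse, in the graph
or in its complement. -/
theorem exists_sparse_sequence.{u, v} {ι : Type u} [Fintype ι] (F : SimpleGraph ι) {ε : ℝ}
    (hε : 0 < ε) (k : ℕ) : ∃ σ : ℝ, 0 < σ ∧ ∃ N : ℕ, ∀ (V : Type v) (G : SimpleGraph V), IsEmpty (F ↪g G) →
      ∀ Y : Finset V, N ≤ Y.card → ∃ (m : ℕ) (A : ℕ → Finset V) (τ : ℕ → SimpleGraph V),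
        σ * Y.card ≤ m ∧ (Fintype.card ι + 1) * m ≤ Y.card ∧
        (∀ i < k, A i ⊆ Y ∧ (A i).card = m ∧ (τ i = G ∨ τ i = Gᶜ)) ∧
        ∀ i < k, ∀ j < i, Disjoint (A i) (A j) ∧
          ∀ a ∈ A i, (((A j).filter ((τ i).Adj a)).card : ℝ) ≤ ε * m := by
  set r := Fintype.card ι + 1 with hr
  have hr0 : (0 : ℝ) < r := by rw [hr]; positivity
  induction k with
  | zero =>
    refine ⟨1 / (2 * r), by positivity, r, fun V G _ Y hY => ⟨Y.card / r, fun _ => ∅,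
      fun _ => G, ?_, Nat.mul_div_le _ _, by simp, by simp⟩⟩
    rw [one_div, inv_mul_le_iff₀ (by positivity)]
    have h0 : 1 ≤ Y.card / r := (Nat.one_le_div_iff (by omega)).2 hY
    have h1 : Y.card < (Y.card / r + 1) * r := by
      rw [mul_comm]; exact Nat.lt_mul_div_succ _ (by omega)
    have h2 : Y.card ≤ 2 * r * (Y.card / r) := by nlinarith
    exact_mod_cast h2
  | succ k ih =>
    obtain ⟨σ, hσ, N, hN⟩ := ih
    set ρ := min 1 (ε * σ) with hρ
    have hρ0 : 0 < ρ := lt_min one_pos (by positivity)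
    set c := ρ ^ Fintype.card ι / (2 * (Fintype.card ι + 1)) with hc
    have hc0 : 0 < c := by positivity
    refine ⟨σ * c, by positivity, max r ⌈N / c⌉₊, fun V G hG Y hY => ?_⟩
    obtain ⟨A, hA, B, hB, hAB, hBc, hBA, J, hJ, hJA⟩ := exists_sparse_pair hG hρ0
      (min_le_left _ _) ((le_max_left _ _).trans hY)
    rw [← hc] at hBc
    obtain ⟨m, D, τ, hm1, hm2, hD1, hD2⟩ := hN V G hG B (by
      have h1 : (N : ℝ) / c ≤ Y.card := (Nat.le_ceil _).trans
        (by exact_mod_cast (le_max_right _ _).trans hY)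
      rw [div_le_iff₀ hc0] at h1
      have h2 : (N : ℝ) ≤ B.card := by linarith
      exact_mod_cast h2)
    obtain ⟨A', hA', hA'm⟩ := Finset.exists_subset_card_eq (s := A) (n := m)
      (Nat.le_of_mul_le_mul_left (hm2.trans hBA) (by omega))
    have hne : ∀ i < k, i ≠ k := fun i hi => hi.ne
    refine ⟨m, Function.update D k A', Function.update τ k J, ?_, ?_, fun i hi => ?_,
      fun i hi j hj => ?_⟩
    · refine le_trans ?_ hm1
      rw [mul_assoc]
      exact mul_le_mul_of_nonneg_left hBc hσ.le
    · exact hm2.trans (Finset.card_le_card hB)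
    · rcases eq_or_ne i k with rfl | hik
      · simp only [Function.update_self]
        exact ⟨hA'.trans hA, hA'm, hJ⟩
      · rw [Function.update_of_ne hik, Function.update_of_ne hik]
        have := hD1 i (by omega)
        exact ⟨this.1.trans hB, this.2⟩
    · rcases eq_or_ne i k with rfl | hik
      · rw [Function.update_self, Function.update_self, Function.update_of_ne hj.ne]
        have hDj := (hD1 j hj).1
        refine ⟨hAB.mono hA' hDj, fun a ha => ?_⟩
        have h1 : (((D j).filter (J.Adj a)).card : ℝ) ≤ ρ * B.card :=
          le_trans (by exact_mod_cast Finset.card_le_card (Finset.filter_subset_filter _ hDj))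
            (hJA a (hA' ha))
        have h2 : ρ * B.card ≤ ε * σ * B.card :=
          mul_le_mul_of_nonneg_right (min_le_right _ _) (Nat.cast_nonneg _)
        nlinarith
      · rw [Function.update_of_ne hik, Function.update_of_ne hik,
          Function.update_of_ne (by omega : j ≠ k)]
        exact hD2 i (by omega) j hj

end

section
open scoped Classical

/-- A union of equal-sized sets with few edges between them has a large subset of small maximum
degree. -/
theorem exists_subset_degree_le {V : Type*} (J : SimpleGraph V) {I : Finset ℕ} {m : ℕ}
    {A : ℕ → Finset V} {ε : ℝ} (hε : 0 < ε) (hI : 1 ≤ ε * I.card)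
    (hA : ∀ i ∈ I, (A i).card = m)
    (hJ : ∀ i ∈ I, ∀ j ∈ I, j < i → Disjoint (A i) (A j) ∧
      ∀ a ∈ A i, (((A j).filter (J.Adj a)).card : ℝ) ≤ ε * m) :
    ∃ X ⊆ I.biUnion A, (m : ℝ) / 2 ≤ X.card ∧
      ∀ x ∈ X, ((X.filter (J.Adj x)).card : ℝ) ≤ 8 * ε * X.card := by
  have hIpos : (0 : ℝ) < I.card := by
    by_contra! h
    nlinarith
  have hI1 : (1 : ℝ) ≤ I.card := by
    have : 0 < I.card := by exact_mod_cast hIpos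
    exact_mod_cast this
  set Y := I.biUnion A with hY
  have hdisj : ∀ i ∈ I, ∀ j ∈ I, i ≠ j → Disjoint (A i) (A j) := by
    intro i hi j hj hij
    rcases lt_or_gt_of_ne hij with h | h
    · exact (hJ j hj i hi h).1.symm
    · exact (hJ i hi j hj h).1
  have hYc : (Y.card : ℝ) = I.card * m := by
    have : Y.card = I.card * m := by
      rw [hY, Finset.card_biUnion hdisj, Finset.sum_congr rfl hA, Finset.sum_const, smul_eq_mul]
    exact_mod_cast this
  let e : Finset V → Finset V → ℝ := fun B C => ∑ b ∈ B, ((C.filter (J.Adj b)).card : ℝ)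
  have hesymm : ∀ B C, e B C = e C B := by
    intro B C
    have : ∑ b ∈ B, (C.filter (J.Adj b)).card = ∑ c ∈ C, (B.filter (J.Adj c)).card := by
      refine (Finset.sum_card_bipartiteAbove_eq_sum_card_bipartiteBelow
        (fun b c => J.Adj b c)).trans ?_
      refine Finset.sum_congr rfl fun c _ => congrArg Finset.card (Finset.filter_congr fun b _ => ?_)
      exact J.adj_comm b c
    simp only [e]
    exact_mod_cast this
  have he : ∀ i ∈ I, ∀ j ∈ I, i ≠ j → e (A i) (A j) ≤ m * (ε * m) := by
    have hlt : ∀ i ∈ I, ∀ j ∈ I, j < i → e (A i) (A j) ≤ m * (ε * m) := by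
      intro i hi j hj hij
      refine (Finset.sum_le_card_nsmul _ _ _ (hJ i hi j hj hij).2).trans ?_
      rw [hA i hi, nsmul_eq_mul]
    intro i hi j hj hij
    rcases lt_or_gt_of_ne hij with h | h
    · rw [hesymm]; exact hlt j hj i hi h
    · exact hlt i hi j hj h
  have he' : ∀ i ∈ I, e (A i) (A i) ≤ m * m := by
    intro i hi
    refine (Finset.sum_le_card_nsmul _ _ (m : ℝ) fun a _ => ?_).trans ?_
    · rw [← hA i hi]
      exact_mod_cast Finset.card_le_card (Finset.filter_subset _ _)
    · rw [hA i hi, nsmul_eq_mul]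
  have htot : e Y Y ≤ 2 * ε * (Y.card * Y.card) := by
    have h1 : e Y Y ≤ ∑ i ∈ I, ∑ j ∈ I, e (A i) (A j) := by
      simp only [e]
      rw [Finset.sum_biUnion hdisj]
      refine Finset.sum_le_sum fun i _ => ?_
      rw [Finset.sum_comm]
      refine Finset.sum_le_sum fun a _ => ?_
      rw [hY, Finset.filter_biUnion]
      exact_mod_cast Finset.card_biUnion_le
    have h2 : ∀ i ∈ I, ∑ j ∈ I, e (A i) (A j) ≤ m * m + I.card * (m * (ε * m)) := by
      intro i hi
      rw [← Finset.add_sum_erase I _ hi]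
      refine add_le_add (he' i hi) ?_
      refine (Finset.sum_le_card_nsmul _ _ (m * (ε * m)) fun j hj =>
        he i hi j (Finset.mem_of_mem_erase hj) (Finset.ne_of_mem_erase hj).symm).trans ?_
      rw [nsmul_eq_mul]
      refine mul_le_mul_of_nonneg_right ?_ (by positivity)
      exact_mod_cast Finset.card_le_card (Finset.erase_subset _ _)
    have h3 := h1.trans (Finset.sum_le_card_nsmul _ _ _ h2)
    rw [nsmul_eq_mul] at h3
    rw [hYc]
    have h4 : (I.card : ℝ) * (m * m) * 1 ≤ I.card * (m * m) * (ε * I.card) :=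
      mul_le_mul_of_nonneg_left hI (by positivity)
    nlinarith
  let X := Y.filter fun x => ((Y.filter (J.Adj x)).card : ℝ) ≤ 4 * ε * Y.card
  have hX : (Y.card : ℝ) ≤ 2 * X.card := by
    have h1 : (Y \ X).card * (4 * ε * Y.card) ≤ e Y Y := by
      calc ((Y \ X).card : ℝ) * (4 * ε * Y.card) ≤ e (Y \ X) Y := by
            rw [← nsmul_eq_mul]
            refine Finset.card_nsmul_le_sum _ _ _ fun x hx => ?_
            rw [Finset.mem_sdiff, Finset.mem_filter] at hx
            push Not at hx
            exact (hx.2 hx.1).le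
        _ ≤ e Y Y := Finset.sum_le_sum_of_subset_of_nonneg Finset.sdiff_subset
            fun _ _ _ => Nat.cast_nonneg _
    have h2 : ((Y \ X).card : ℝ) + X.card = Y.card := by
      exact_mod_cast Finset.card_sdiff_add_card_eq_card (Finset.filter_subset _ _)
    rcases (Nat.cast_nonneg Y.card : (0 : ℝ) ≤ Y.card).eq_or_lt with h0 | h0
    · rw [← h0]; positivity
    · have h3 : ((Y \ X).card : ℝ) * 2 ≤ Y.card := by
        have h4 : 0 < 2 * ε * Y.card := by positivity
        refine le_of_mul_le_mul_right ?_ h4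
        nlinarith
      linarith
  refine ⟨X, Finset.filter_subset _ _, ?_, fun x hx => ?_⟩
  · have : (0 : ℝ) ≤ m := Nat.cast_nonneg _
    nlinarith
  · have h1 := (Finset.mem_filter.1 hx).2
    have h2 : ((X.filter (J.Adj x)).card : ℝ) ≤ (Y.filter (J.Adj x)).card := by
      exact_mod_cast Finset.card_le_card
        (Finset.filter_subset_filter _ (Finset.filter_subset _ _))
    nlinarith

/-- **Rödl's theorem**: a graph without induced copies of a given pattern has a set of linear size
on which the graph or its complement has small maximum degree. -/
theorem exists_sparse_subset.{u, v} {ι : Type u} [Fintype ι] (F : SimpleGraph ι) {ε : ℝ}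
    (hε : 0 < ε) : ∃ σ : ℝ, 0 < σ ∧ ∃ N : ℕ, ∀ (V : Type v) [Fintype V] (G : SimpleGraph V),
      IsEmpty (F ↪g G) → N ≤ Fintype.card V → ∃ X : Finset V, σ * Fintype.card V ≤ X.card ∧
        ∃ J : SimpleGraph V, (J = G ∨ J = Gᶜ) ∧
          ∀ x ∈ X, ((X.filter (J.Adj x)).card : ℝ) ≤ ε * X.card := by
  obtain ⟨p, hp⟩ := exists_nat_ge (1 / (ε / 8))
  have hε8 : 0 < ε / 8 := by positivity
  rw [div_le_iff₀ hε8] at hp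
  obtain ⟨σ, hσ, N, hN⟩ := exists_sparse_sequence.{u, v} F hε8 (p + p)
  refine ⟨σ / 2, by positivity, N, fun V _ G hG hV => ?_⟩
  obtain ⟨m, A, τ, hm, -, hA, hA'⟩ := hN V G hG Finset.univ (by rwa [Finset.card_univ])
  rw [Finset.card_univ] at hm
  let I := (Finset.range (p + p)).filter fun i => τ i = G
  let I' := (Finset.range (p + p)).filter fun i => ¬ τ i = G
  have hII' : I.card + I'.card = p + p := by
    rw [Finset.card_filter_add_card_filter_not, Finset.card_range]
  obtain ⟨J, hJ, K, hK, hKp, hKJ⟩ : ∃ J : SimpleGraph V, (J = G ∨ J = Gᶜ) ∧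
      ∃ K ⊆ Finset.range (p + p), p ≤ K.card ∧ ∀ i ∈ K, τ i = J := by
    rcases Nat.lt_or_ge I.card p with h | h
    · refine ⟨Gᶜ, Or.inr rfl, I', Finset.filter_subset _ _, by omega, fun i hi => ?_⟩
      obtain ⟨hi, hne⟩ := Finset.mem_filter.1 hi
      exact (hA i (Finset.mem_range.1 hi)).2.2.resolve_left hne
    · exact ⟨G, Or.inl rfl, I, Finset.filter_subset _ _, h, fun i hi => (Finset.mem_filter.1 hi).2⟩
  have hKlt : ∀ i ∈ K, i < p + p := fun i hi => Finset.mem_range.1 (hK hi)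
  obtain ⟨X, -, hX, hXd⟩ := exists_subset_degree_le J hε8 (I := K) (A := A) (m := m)
    (by
      have : (p : ℝ) ≤ K.card := by exact_mod_cast hKp
      nlinarith)
    (fun i hi => (hA i (hKlt i hi)).2.1)
    (fun i hi j _ hji => by
      have := hA' i (hKlt i hi) j hji
      rwa [hKJ i hi] at this)
  refine ⟨X, by linarith, J, hJ, fun x hx => ?_⟩
  have := hXd x hx
  linarith

/-- The graph obtained from `H` by subdividing each edge once, with an isolated
vertex added for each non-edge. -/
def edgeIncidenceGraph {U : Type*} (H : SimpleGraph U) : SimpleGraph (U ⊕ Sym2 U) where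
  Adj
    | Sum.inl u, Sum.inr e => e ∈ H.edgeSet ∧ u ∈ e
    | Sum.inr e, Sum.inl u => e ∈ H.edgeSet ∧ u ∈ e
    | _, _ => False
  symm := ⟨by rintro (u | e) (w | f) h <;> exact h⟩
  loopless := ⟨by rintro (u | e) h <;> exact h⟩

/-- An induced copy of the incidence graph is a template. -/
def SubdivisionTemplate.ofEmbedding {V U : Type*} {G : SimpleGraph V} {H : SimpleGraph U}
    (f : edgeIncidenceGraph H ↪g G) : SubdivisionTemplate G H where
  vert u := f (Sum.inl u)
  inj := f.injective.comp Sum.inl_injective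
  not_adj u w h := f.map_adj_iff.1 h
  link e := {f (Sum.inr e)}
  conn e _ := CutConnected.singleton _
  attach e he u hu := ⟨f (Sum.inr e), by simp, f.map_adj_iff.2 ⟨he, hu⟩⟩
  not_mem e _ u h := by simp at h
  no_attach e he u hu a ha h := by
    rw [Finset.mem_singleton.1 ha] at h
    exact hu (f.map_adj_iff.1 h).2
  apart e _ e' _ hne a ha b hb := by
    rw [Finset.mem_singleton.1 ha, Finset.mem_singleton.1 hb]
    exact ⟨fun h => hne (Sum.inr_injective (f.injective h)), fun h => f.map_adj_iff.1 h⟩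

/-- Two disjoint sets of vertices with all edges or no edges between them. -/
def IsPurePair {V : Type*} (G : SimpleGraph V) (A B : Finset V) : Prop :=
  Disjoint A B ∧ ((∀ a ∈ A, ∀ b ∈ B, G.Adj a b) ∨ ∀ a ∈ A, ∀ b ∈ B, ¬ G.Adj a b)

theorem IsPurePair.of_compl {V : Type*} {G : SimpleGraph V} {A B : Finset V}
    (h : IsPurePair Gᶜ A B) : IsPurePair G A B := by
  refine ⟨h.1, h.2.symm.imp (fun h' a ha b hb => ?_) fun h' a ha b hb => ?_⟩
  · by_contra hab
    exact h' a ha b hb ((G.compl_adj a b).2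
      ⟨fun hab' => Finset.disjoint_left.1 h.1 ha (hab' ▸ hb), hab⟩)
  · exact ((G.compl_adj a b).1 (h' a ha b hb)).2

/-- A sparse graph without templates has a linear pure pair. -/
theorem exists_isPurePair_of_sparse {V : Type*} {J : SimpleGraph V} {U : Type*}
    {H : SimpleGraph U} (hJ : IsEmpty (SubdivisionTemplate J H)) {ε : ℝ}
    {X : Finset V}
    (hε : ∀ (G : SimpleGraph X), IsCoherent G ε → Nonempty (SubdivisionTemplate G H))
    (hX : ∀ x ∈ X, 1 + ((X.filter (J.Adj x)).card : ℝ) ≤ ε * X.card) :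
    ∃ A B : Finset V, IsPurePair J A B ∧ ε * X.card ≤ (A.card : ℝ) ∧
      ε * X.card ≤ (B.card : ℝ) := by
  let f : X ↪ V := Function.Embedding.subtype _
  let G : SimpleGraph X := J.comap f
  have hG : ¬ IsCoherent G ε := fun hG => by
    obtain ⟨T⟩ := hε G hG
    exact hJ.false (T.map (SimpleGraph.Embedding.comap f J))
  by_contra hcon
  refine hG ⟨fun v => ?_, fun A B hAB => ?_⟩
  · rw [Fintype.card_coe]
    refine le_trans ?_ (hX v v.2)
    have hsub : (closedNbhd G {v}).map f ⊆ insert (v : V) (X.filter (J.Adj v)) := by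
      intro x hx
      obtain ⟨y, hy, rfl⟩ := Finset.mem_map.1 hx
      rw [mem_closedNbhd_singleton] at hy
      rcases hy with rfl | hy
      · exact Finset.mem_insert_self _ _
      · exact Finset.mem_insert_of_mem (Finset.mem_filter.2 ⟨y.2, hy⟩)
    have h1 := (Finset.card_le_card hsub).trans (Finset.card_insert_le _ _)
    rw [Finset.card_map] at h1
    have h2 : ((closedNbhd G {v}).card : ℝ) ≤ (X.filter (J.Adj v)).card + 1 := by
      exact_mod_cast h1
    linarith
  · rw [Fintype.card_coe]
    by_contra! hge
    refine hcon ⟨A.map f, B.map f, ⟨?_, Or.inr ?_⟩, ?_, ?_⟩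
    · rw [Finset.disjoint_map, Finset.disjoint_left]
      exact fun a ha hb => (hAB a ha a hb).1 rfl
    · intro a ha b hb hab
      obtain ⟨a, ha', rfl⟩ := Finset.mem_map.1 ha
      obtain ⟨b, hb', rfl⟩ := Finset.mem_map.1 hb
      exact (hAB a ha' b hb').2 hab
    · rw [Finset.card_map]; exact hge.1
    · rw [Finset.card_map]; exact hge.2

/-- Graphs for which neither the graph nor its complement has a template have linear pure pairs. -/
theorem exists_isPurePair.{u, v} {U : Type u} [Fintype U] (H : SimpleGraph U) :
    ∃ ε : ℝ, 0 < ε ∧ ε < 1 ∧ ∀ (V : Type v) [Fintype V] (G : SimpleGraph V),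
      IsEmpty (SubdivisionTemplate G H) → IsEmpty (SubdivisionTemplate Gᶜ H) →
      2 ≤ Fintype.card V → ∃ A B : Finset V, IsPurePair G A B ∧
        ε * Fintype.card V ≤ A.card ∧ ε * Fintype.card V ≤ B.card := by
  obtain ⟨ε, hε, hS⟩ := exists_coherent_nonempty_template.{u, v} H
  obtain ⟨σ, hσ, N, hN⟩ := exists_sparse_subset.{u, v} (edgeIncidenceGraph H) (half_pos hε)
  obtain ⟨n₀, hn₀⟩ := exists_nat_ge (max (N : ℝ) (2 / (ε * σ)))
  refine ⟨min (1 / 2) (min (ε * σ) (1 / (n₀ + 1))), by positivity,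
    (min_le_left _ _).trans_lt (by norm_num), fun V _ G hG hGc hV => ?_⟩
  set δ := min (1 / 2) (min (ε * σ) (1 / ((n₀ : ℝ) + 1))) with hδ
  have hδ1 : δ ≤ ε * σ := (min_le_right _ _).trans (min_le_left _ _)
  have hδ2 : δ ≤ 1 / (n₀ + 1) := (min_le_right _ _).trans (min_le_right _ _)
  have hVpos : (0 : ℝ) < Fintype.card V := by
    have : 0 < Fintype.card V := by omega
    exact_mod_cast this
  rcases Nat.lt_or_ge (Fintype.card V) n₀ with hlt | hge
  · have : Nontrivial V := Fintype.one_lt_card_iff_nontrivial.1 hV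
    obtain ⟨x, y, hxy⟩ := exists_pair_ne V
    have h1 : δ * Fintype.card V ≤ 1 := by
      have h2 : (Fintype.card V : ℝ) ≤ n₀ := by exact_mod_cast hlt.le
      calc δ * Fintype.card V ≤ 1 / (n₀ + 1) * (n₀ + 1) :=
            mul_le_mul hδ2 (by linarith) hVpos.le (by positivity)
        _ = 1 := one_div_mul_cancel (by positivity)
    refine ⟨{x}, {y}, ⟨by simpa using hxy, ?_⟩, by simpa using h1, by simpa using h1⟩
    by_cases h : G.Adj x y
    · exact Or.inl (by simpa using h)
    · exact Or.inr (by simpa using h)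
  · have hge' : (n₀ : ℝ) ≤ Fintype.card V := by exact_mod_cast hge
    obtain ⟨X, hX, J, hJ, hXJ⟩ := hN V G ⟨fun f => hG.false (.ofEmbedding f)⟩ (by
      have : (N : ℝ) ≤ Fintype.card V := ((le_max_left _ _).trans hn₀).trans hge'
      exact_mod_cast this)
    have hXbig : 2 ≤ ε * X.card := by
      have h1 : 2 / (ε * σ) ≤ Fintype.card V := ((le_max_right _ _).trans hn₀).trans hge'
      rw [div_le_iff₀ (by positivity)] at h1
      nlinarith
    have hXne : X.Nonempty := by
      rw [← Finset.card_pos]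
      have : (0 : ℝ) < X.card := lt_of_lt_of_le (by positivity) hX
      exact_mod_cast this
    have : Nonempty X := hXne.to_subtype
    have hJT : IsEmpty (SubdivisionTemplate J H) := by
      rcases hJ with rfl | rfl
      · exact hG
      · exact hGc
    obtain ⟨A, B, hAB, hA, hB⟩ := exists_isPurePair_of_sparse hJT (ε := ε)
      (fun K => hS X K) (fun x hx => by
        have := hXJ x hx
        linarith)
    have hδX : δ * Fintype.card V ≤ ε * X.card := by
      calc δ * Fintype.card V ≤ ε * σ * Fintype.card V := mul_le_mul_of_nonneg_right hδ1 hVpos.le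
        _ = ε * (σ * Fintype.card V) := by ring
        _ ≤ ε * X.card := mul_le_mul_of_nonneg_left hX hε.le
    refine ⟨A, B, ?_, hδX.trans hA, hδX.trans hB⟩
    rcases hJ with rfl | rfl
    · exact hAB
    · exact hAB.of_compl

end

section
open scoped Classical

/-- Linear pure pairs inside every set give a clique and a stable set whose sizes have a
polynomially large product. -/
theorem exists_clique_indepSet_of_pure_pairs {V : Type*} {G : SimpleGraph V} {ε τ : ℝ}
    (hε : 0 < ε) (hτ : 0 < τ) (hετ : 1 ≤ 2 * ε ^ τ)
    (hG : ∀ X : Finset V, 2 ≤ X.card → ∃ A ⊆ X, ∃ B ⊆ X, IsPurePair G A B ∧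
      ε * X.card ≤ A.card ∧ ε * X.card ≤ B.card) :
    ∀ X : Finset V, X.Nonempty → ∃ K ⊆ X, ∃ I ⊆ X, G.IsClique (K : Set V) ∧
      G.IsIndepSet (I : Set V) ∧ (X.card : ℝ) ^ τ ≤ K.card * I.card := by
  intro X
  induction X using Finset.strongInductionOn with
  | _ X ih =>
    intro hX
    rcases Nat.lt_or_ge X.card 2 with hlt | hge
    · have h1 : X.card = 1 := by
        have := Finset.card_pos.2 hX
        omega
      obtain ⟨x, rfl⟩ := Finset.card_eq_one.1 h1
      exact ⟨{x}, subset_rfl, {x}, subset_rfl, by simp, by simp [SimpleGraph.IsIndepSet], by simp⟩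
    obtain ⟨A, hAX, B, hBX, ⟨hdisj, hpure⟩, hA, hB⟩ := hG X hge
    have hXpos : (0 : ℝ) < X.card := by exact_mod_cast Finset.card_pos.2 hX
    have hAne : A.Nonempty := by
      rw [← Finset.card_pos]
      have : (0 : ℝ) < A.card := lt_of_lt_of_le (by positivity) hA
      exact_mod_cast this
    have hBne : B.Nonempty := by
      rw [← Finset.card_pos]
      have : (0 : ℝ) < B.card := lt_of_lt_of_le (by positivity) hB
      exact_mod_cast this
    obtain ⟨K₁, hK₁, I₁, hI₁, hKc₁, hIc₁, h₁⟩ := ih A (hAX.ssubset_of_ne fun h => by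
      obtain ⟨b, hb⟩ := hBne
      exact Finset.disjoint_left.1 hdisj (h ▸ hBX hb) hb) hAne
    obtain ⟨K₂, hK₂, I₂, hI₂, hKc₂, hIc₂, h₂⟩ := ih B (hBX.ssubset_of_ne fun h => by
      obtain ⟨a, ha⟩ := hAne
      exact Finset.disjoint_left.1 hdisj ha (h ▸ hAX ha)) hBne
    have hpow : ∀ {n : ℕ}, ε * X.card ≤ n → ε ^ τ * (X.card : ℝ) ^ τ ≤ (n : ℝ) ^ τ := by
      intro n hn
      rw [← Real.mul_rpow hε.le hXpos.le]
      exact Real.rpow_le_rpow (by positivity) hn hτ.le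
    have hsum : (X.card : ℝ) ^ τ ≤ (A.card : ℝ) ^ τ + (B.card : ℝ) ^ τ := by
      have h3 := hpow hA
      have h4 := hpow hB
      have h5 : 0 ≤ (X.card : ℝ) ^ τ := by positivity
      nlinarith
    have hunion : ∀ {S₁ S₂ : Finset V}, S₁ ⊆ A → S₂ ⊆ B →
        ((S₁ ∪ S₂).card : ℝ) = S₁.card + S₂.card := by
      intro S₁ S₂ h1 h2
      exact_mod_cast Finset.card_union_of_disjoint (hdisj.mono h1 h2)
    have hmul : ∀ a b c d e : ℕ, (A.card : ℝ) ^ τ ≤ a * c → (B.card : ℝ) ^ τ ≤ b * d →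
        c ≤ e → d ≤ e → (X.card : ℝ) ^ τ ≤ (a + b) * e := by
      intro a b c d e h1 h2 hce hde
      have h3 : (a * c : ℝ) ≤ a * e :=
        mul_le_mul_of_nonneg_left (by exact_mod_cast hce) (Nat.cast_nonneg _)
      have h4 : (b * d : ℝ) ≤ b * e :=
        mul_le_mul_of_nonneg_left (by exact_mod_cast hde) (Nat.cast_nonneg _)
      linarith
    rcases hpure with hcomp | hanti
    · have hK : G.IsClique ((K₁ ∪ K₂ : Finset V) : Set V) := by
        intro x hx y hy hxy
        rw [Finset.mem_coe, Finset.mem_union] at hx hy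
        rcases hx with hx | hx <;> rcases hy with hy | hy
        · exact hKc₁ hx hy hxy
        · exact hcomp x (hK₁ hx) y (hK₂ hy)
        · exact (hcomp y (hK₁ hy) x (hK₂ hx)).symm
        · exact hKc₂ hx hy hxy
      rcases le_total I₁.card I₂.card with hle | hle
      · refine ⟨K₁ ∪ K₂, Finset.union_subset (hK₁.trans hAX) (hK₂.trans hBX), I₂,
          hI₂.trans hBX, hK, hIc₂, ?_⟩
        rw [hunion hK₁ hK₂]
        exact hmul _ _ _ _ _ h₁ h₂ hle le_rfl
      · refine ⟨K₁ ∪ K₂, Finset.union_subset (hK₁.trans hAX) (hK₂.trans hBX), I₁,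
          hI₁.trans hAX, hK, hIc₁, ?_⟩
        rw [hunion hK₁ hK₂]
        exact hmul _ _ _ _ _ h₁ h₂ le_rfl hle
    · have hI : G.IsIndepSet ((I₁ ∪ I₂ : Finset V) : Set V) := by
        intro x hx y hy hxy
        rw [Finset.mem_coe, Finset.mem_union] at hx hy
        rcases hx with hx | hx <;> rcases hy with hy | hy
        · exact hIc₁ hx hy hxy
        · exact hanti x (hI₁ hx) y (hI₂ hy)
        · exact fun h => hanti y (hI₁ hy) x (hI₂ hx) h.symm
        · exact hIc₂ hx hy hxy
      rw [mul_comm] at h₁ h₂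
      rcases le_total K₁.card K₂.card with hle | hle
      · refine ⟨K₂, hK₂.trans hBX, I₁ ∪ I₂,
          Finset.union_subset (hI₁.trans hAX) (hI₂.trans hBX), hKc₂, hI, ?_⟩
        rw [hunion hI₁ hI₂, mul_comm]
        exact hmul _ _ _ _ _ h₁ h₂ hle le_rfl
      · refine ⟨K₁, hK₁.trans hAX, I₁ ∪ I₂,
          Finset.union_subset (hI₁.trans hAX) (hI₂.trans hBX), hKc₁, hI, ?_⟩
        rw [hunion hI₁ hI₂, mul_comm]
        exact hmul _ _ _ _ _ h₁ h₂ le_rfl hle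

/-- Linear pure pairs inside every subset, from linear pure pairs in every graph. -/
theorem exists_isPurePair_subset {V U : Type*} {G : SimpleGraph V} {H : SimpleGraph U} {ε : ℝ}
    {X : Finset V} (hG : IsEmpty (SubdivisionTemplate G H))
    (hGc : IsEmpty (SubdivisionTemplate Gᶜ H))
    (hX : ∀ K : SimpleGraph X, IsEmpty (SubdivisionTemplate K H) →
      IsEmpty (SubdivisionTemplate Kᶜ H) → ∃ A B : Finset X, IsPurePair K A B ∧
        ε * Fintype.card X ≤ A.card ∧ ε * Fintype.card X ≤ B.card) :
    ∃ A ⊆ X, ∃ B ⊆ X, IsPurePair G A B ∧ ε * X.card ≤ A.card ∧ ε * X.card ≤ B.card := by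
  let f : X ↪ V := Function.Embedding.subtype _
  have hsub : ∀ A : Finset X, A.map f ⊆ X := by
    intro A x hx
    obtain ⟨y, -, rfl⟩ := Finset.mem_map.1 hx
    exact y.2
  obtain ⟨A, B, ⟨hAB, hpure⟩, hA, hB⟩ := hX (G.comap f)
    ⟨fun T => hG.false (T.map (SimpleGraph.Embedding.comap f G))⟩
    ⟨fun T => hGc.false (T.map ⟨f, fun {a b} => by
      simp [SimpleGraph.compl_adj, f.injective.eq_iff]⟩)⟩
  rw [Fintype.card_coe] at hA hB
  refine ⟨A.map f, hsub A, B.map f, hsub B, ⟨(Finset.disjoint_map f).2 hAB, ?_⟩, ?_, ?_⟩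
  · refine hpure.imp (fun h a ha b hb => ?_) fun h a ha b hb => ?_
    all_goals
      obtain ⟨a, ha', rfl⟩ := Finset.mem_map.1 ha
      obtain ⟨b, hb', rfl⟩ := Finset.mem_map.1 hb
      exact h a ha' b hb'
  · rwa [Finset.card_map]
  · rwa [Finset.card_map]

end

theorem mainTheorem6 {U : Type*} [Fintype U] (H : SimpleGraph U) :
    ∃ c : ℝ, 0 < c ∧ ∀ (V : Type*) [Fintype V] (G : SimpleGraph V),
      (ContainsInducedSubdivision G H ∨ ContainsInducedSubdivision Gᶜ H) ∨
      ∃ s : Finset V, (G.IsClique (s : Set V) ∨ G.IsIndepSet (s : Set V)) ∧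
        (Fintype.card V : ℝ) ^ c ≤ (s.card : ℝ) := by
  obtain ⟨ε, hε, hε1, hP⟩ := exists_isPurePair H
  have hlog : Real.log ε < 0 := Real.log_neg hε hε1
  obtain ⟨τ, hτ, hετ⟩ : ∃ τ : ℝ, 0 < τ ∧ 1 ≤ 2 * ε ^ τ := by
    refine ⟨Real.log 2 / -Real.log ε, div_pos (Real.log_pos (by norm_num)) (by linarith), ?_⟩
    have h1 : Real.log ε * (Real.log 2 / -Real.log ε) = -Real.log 2 := by
      have := hlog.ne
      field_simp
    rw [Real.rpow_def_of_pos hε, h1, Real.exp_neg, Real.exp_log (by norm_num)]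
    norm_num
  refine ⟨τ / 2, by positivity, fun V _ G => ?_⟩
  by_cases hsub : ContainsInducedSubdivision G H ∨ ContainsInducedSubdivision Gᶜ H
  · exact Or.inl hsub
  right
  push Not at hsub
  have hG : IsEmpty (SubdivisionTemplate G H) := ⟨fun T => hsub.1 T.containsInducedSubdivision⟩
  have hGc : IsEmpty (SubdivisionTemplate Gᶜ H) := ⟨fun T => hsub.2 T.containsInducedSubdivision⟩
  rcases isEmpty_or_nonempty V with hV | hV
  · refine ⟨∅, Or.inl (by simp), ?_⟩
    rw [Fintype.card_eq_zero, Nat.cast_zero, Real.zero_rpow (by positivity)]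
    simp
  obtain ⟨K, -, I, -, hK, hI, hKI⟩ := exists_clique_indepSet_of_pure_pairs hε hτ hετ
    (fun X hX => exists_isPurePair_subset hG hGc fun K hK hKc =>
      hP X K hK hKc (by rwa [Fintype.card_coe])) Finset.univ Finset.univ_nonempty
  rw [Finset.card_univ] at hKI
  by_contra! hcon
  have h1 := hcon K (Or.inl hK)
  have h2 := hcon I (Or.inr hI)
  have h3 : (Fintype.card V : ℝ) ^ (τ / 2) * (Fintype.card V : ℝ) ^ (τ / 2) =
      (Fintype.card V : ℝ) ^ τ := by
    rw [← Real.rpow_add (by exact_mod_cast Fintype.card_pos), add_halves]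
  have h4 := mul_lt_mul'' h1 h2 (Nat.cast_nonneg _) (Nat.cast_nonneg _)
  rw [h3] at h4
  exact absurd hKI (not_le.2 h4)
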